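/- A promise problem over a finite alphabet $\Gamma$ is a pair $A=(A_{yes},A_{no})$ of disjoint subsets of $\Gamma^*$. Let $\mathsf{QMA}$ be the class of promise problems having a polynomial-time quantum verifier: a Turing machine with a read-only input tape, a classical work tape, a work tape of qubits, a constant-size quantum register acted on (together with the scanned work qubit) by selective quantum operations with algebraic entries, and a tape holding a quantum proof of finitely many qubits that is read one way. It halts in polynomial time on every input and proof, accepts every yes-instance with probability at least $2/3$ for some proof, and rejects every no-instance with probability at least $2/3$ for all proofs. A problem is $\mathsf{QMA}$-complete if it is in $\mathsf{QMA}$ and every problem in $\mathsf{QMA}$ is reducible to it by a classical polynomial-time (Karp) reduction. Let $\mathsf{BQTIME}(t(n))$ be the class of promise problems solved by a stand-alone quantum Turing machine (no proof) that halts within $t(n)$ steps on all inputs of length $n$ and gives the right verdict on yes- and no-instances with probability at least $2/3$. Let $\mathsf{MATIME}(t(n))$ be the class of promise problems with a classical Merlin–Arthur verifier: a probabilistic Turing machine that halts within $t(n)$ steps on every input of length $n$ and every certificate, accepts every yes-instance with probability at least $2/3$ for some certificate, and rejects every no-instance with probability at least $2/3$ for all certificates. $\mathsf{BQP}$ and $\mathsf{MA}$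 are the unions of these classes over all polynomials $t$. The hypothesis ETH-QMA states that for every function $t(n)\in 2^{n^{o(1)}}$, the set $\mathsf{MATIME}(t(n))\cup\mathsf{BQTIME}(t(n))$ contains no $\mathsf{QMA}$-complete problem. For an integer $l\ge 0$ let $\mathrm{bin}(l)$ be its shortest binary representation (with $\mathrm{bin}(0)=0$), and for an integer $m\ge 1$ let $u_m=\mathrm{bin}(0)\$\mathrm{bin}(1)\$\cdots\$\mathrm{bin}(2^m-1)$. Let $\Sigma=\{0,1,\$\}\times\{0,1,\#\}$; a string over $\Sigma$ has an upper track over $\{0,1,\$\}$ and a lower track over $\{0,1,\#\}$. A string over $\Sigma$ is a padding of $w\in\{0,1\}^*$ if, for some $m\ge 1$, its upper track is $u_m$, its lower track is $w\,\#^{|u_m|-|w|}$, and $|w|\le 2^{m/|\mathrm{bin}(m)|}$. For $L\subseteq\{0,1\}^*$ let $pad(L)$ be the set of all paddings of members of $L$. Let $\mathcal F$ be the family of all promise problems $A'$ over $\Sigma$ with $$A'_{yes}=pad(A_{yes}),\qquad A'_{no}=pad(A_{no})\cup\bigl(\Sigma^*\setminus pad(\{0,1\}^*)\bigr),$$ where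 $A=(A_{yes},A_{no})$ is a $\mathsf{QMA}$-complete promise problem over $\{0,1\}$. Theorem. If ETH-QMA holds, then no member of $\mathcal F$ belongs to $\mathsf{BQP}$, and no member of $\mathcal F$ belongs to $\mathsf{MA}$. -/

import Mathlib

namespace PaddedQMA

open Filter Topology Matrix

noncomputable section

/-! ### Promise problems, tapes -/

/-- A promise problem over the alphabet `Γ`. -/
@[ext]
structure PromiseProblem (Γ : Type) where
  yes : Set (List Γ)
  no : Set (List Γ)
  disjoint : Disjoint yes no

/-- The contents of a cell of a read-only tape: a letter or one of the two endmarkers. -/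
inductive TapeSym (Γ : Type) where
  | leftEnd : TapeSym Γ
  | letter (a : Γ) : TapeSym Γ
  | rightEnd : TapeSym Γ

/-- The tape `▷ w ◁`: the left endmarker is in cell `0`. -/
def tapeOf {Γ : Type} (w : List Γ) : ℕ → TapeSym Γ
  | 0 => TapeSym.leftEnd
  | i + 1 => match w[i]? with
    | some a => TapeSym.letter a
    | none => TapeSym.rightEnd

/-- Head movements `-1, 0, 1`. -/
inductive Dir where
  | left : Dir
  | stay : Dir
  | right : Dir

/-- Movement on a one-way infinite tape; a head on the leftmost cell cannot move left. -/
def Dir.move : Dir → ℕ → ℕ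
  | .left, i => i - 1
  | .stay, i => i
  | .right, i => i + 1

/-- Movement on the tape `▷ w ◁` with `w` of length `n`; the head never leaves this area. -/
def Dir.moveOn (d : Dir) (n i : ℕ) : ℕ := min (d.move i) (n + 1)

/-! ### Quantum Turing machines -/

/-- Computational basis of the quantum register (`k` qubits) together with the qubit scanned
on the quantum work tape. -/
abbrev LocalBasis (k : ℕ) : Type := (Fin k → Bool) × Bool

/-- A selective quantum operation on `k + 1` qubits with outcomes in `T`, in operator-sum form
with algebraic matrix entries: outcome `τ` corresponds to `ρ ↦ ∑ i, E τ i * ρ * (E τ i)ᴴ`. -/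
structure SelectiveOp (T : Type) [Fintype T] (k : ℕ) where
  r : ℕ
  E : T → Fin r → Matrix (LocalBasis k) (LocalBasis k) ℂ
  complete : ∑ τ, ∑ i, (E τ i)ᴴ * E τ i = 1
  algebraic : ∀ τ i x y, IsAlgebraic ℚ (E τ i x y)

/-- The updates prescribed by a second-stage transition. -/
structure QUpdate (S K : Type) (c : ℕ) where
  state : S
  write : Fin c → K
  inDir : Dir
  workDir : Fin c → Dir
  qDir : Dir
  readProof : Bool

/-- A quantum Turing machine with input alphabet `Γ`, a quantum register, a quantum work tape,
a one-way proof tape of qubits and `c` classical work tapes. The values of the transition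
functions at the two halting states are irrelevant. -/
structure QuantumMachine (Γ : Type) (c : ℕ) where
  S : Type
  K : Type
  T : Type
  [finS : Fintype S]
  [finK : Fintype K]
  [finT : Fintype T]
  k : ℕ
  k_pos : 0 < k
  blank : K
  δ₁ : S → TapeSym Γ → (Fin c → K) → SelectiveOp T k
  δ₂ : S → TapeSym Γ → (Fin c → K) → T → QUpdate S K c
  s₀ : S
  τ₀ : T
  acc : S
  rej : S
  acc_ne_rej : acc ≠ rej

attribute [instance] QuantumMachine.finS QuantumMachine.finK QuantumMachine.finT

/-- A quantum verifier has a single classical work tape. -/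
abbrev QuantumVerifier (Γ : Type) : Type 1 := QuantumMachine Γ 1

/-- Computational basis of all qubits: quantum register, quantum work tape, proof tape with
`m` qubits. -/
abbrev QBasis (k m : ℕ) : Type := (Fin k → Bool) × (ℕ → Bool) × (Fin m → Bool)

/-- Vectors that are finite combinations of basis states. -/
abbrev QVec (k m : ℕ) : Type := QBasis k m →₀ ℂ

/-- Squared Euclidean norm. -/
def normSq {k m : ℕ} (ψ : QVec k m) : ℝ := ψ.sum fun _ a => ‖a‖ ^ 2

/-- Apply a matrix to the quantum register and the qubit in cell `h` of the quantum work tape. -/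
def applyLocal {k m : ℕ} (E : Matrix (LocalBasis k) (LocalBasis k) ℂ) (h : ℕ) (ψ : QVec k m) :
    QVec k m :=
  ψ.sum fun x a => ∑ y : LocalBasis k,
    Finsupp.single (y.1, Function.update x.2.1 h y.2, x.2.2) (E y (x.1, x.2.1 h) * a)

/-- Swap qubit `q` of the quantum register with proof qubit `j`. -/
def swapProof {k m : ℕ} (q : Fin k) (j : Fin m) (ψ : QVec k m) : QVec k m :=
  ψ.mapDomain fun x =>
    (Function.update x.1 q (x.2.2 j), x.2.1, Function.update x.2.2 j (x.1 q))

/-- Pure states of `m` proof qubits. -/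
def IsState {m : ℕ} (φ : (Fin m → Bool) → ℂ) : Prop := ∑ x, ‖φ x‖ ^ 2 = 1

/-- All qubits zero except for the proof qubits, which are in state `φ`. -/
def initVec (k : ℕ) {m : ℕ} (φ : (Fin m → Bool) → ℂ) : QVec k m :=
  ∑ x, Finsupp.single (fun _ => false, fun _ => false, x) (φ x)

namespace QuantumMachine

variable {Γ : Type} {c : ℕ} (V : QuantumMachine Γ c)

/-- The classical part of a configuration. -/
structure Cfg where
  state : V.S
  meas : V.T
  inPos : ℕ
  work : Fin c → ℕ → V.K
  workPos : Fin c → ℕ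
  qPos : ℕ
  proofPos : ℕ

/-- Initial configuration. -/
def initCfg : V.Cfg where
  state := V.s₀
  meas := V.τ₀
  inPos := 0
  work := fun _ _ => V.blank
  workPos := fun _ => 0
  qPos := 0
  proofPos := 0

variable {V}

/-- The classical work symbols under the heads. -/
def Cfg.scan (C : V.Cfg) : Fin c → V.K := fun i => C.work i (C.workPos i)

/-- The first-stage operation performed in a configuration. -/
def Cfg.op (C : V.Cfg) (w : List Γ) : SelectiveOp V.T V.k :=
  V.δ₁ C.state (tapeOf w C.inPos) C.scan

/-- The second-stage transition after measurement outcome `τ`. -/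
def Cfg.upd (C : V.Cfg) (w : List Γ) (τ : V.T) : QUpdate V.S V.K c :=
  V.δ₂ C.state (tapeOf w C.inPos) C.scan τ

/-- Classical part of the second stage. The proof head cannot leave the `m` proof cells. -/
def Cfg.next (C : V.Cfg) (w : List Γ) (m : ℕ) (τ : V.T) : V.Cfg where
  state := (C.upd w τ).state
  meas := τ
  inPos := (C.upd w τ).inDir.moveOn w.length C.inPos
  work := fun i => Function.update (C.work i) (C.workPos i) ((C.upd w τ).write i)
  workPos := fun i => ((C.upd w τ).workDir i).move (C.workPos i)
  qPos := (C.upd w τ).qDir.move C.qPos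
  proofPos := if (C.upd w τ).readProof = true ∧ C.proofPos + 1 < m then C.proofPos + 1
    else C.proofPos

/-- Quantum part of the second stage: if the proof head moves, the qubit at its new position is
swapped with the first qubit of the quantum register. -/
def Cfg.readProof (C : V.Cfg) (w : List Γ) {m : ℕ} (τ : V.T) (ψ : QVec V.k m) : QVec V.k m :=
  if h : (C.upd w τ).readProof = true ∧ C.proofPos + 1 < m then
    swapProof ⟨0, V.k_pos⟩ ⟨C.proofPos + 1, h.2⟩ ψ
  else ψ

variable (V)

open Classical in
/-- The probability with which `V`, started in configuration `C` with qubits in the (possibly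
unnormalized) state `ψ`, has halted in the state `target` after at most `N` steps. -/
def haltProb (w : List Γ) {m : ℕ} (target : V.S) : ℕ → V.Cfg → QVec V.k m → ℝ
  | 0, C, ψ => if C.state = target then normSq ψ else 0
  | N + 1, C, ψ =>
    if C.state = V.acc ∨ C.state = V.rej then
      if C.state = target then normSq ψ else 0
    else
      ∑ τ, ∑ i, haltProb w target N (C.next w m τ)
        (C.readProof w τ (applyLocal ((C.op w).E τ i) C.qPos ψ))

/-- Probability of acceptance within `N` steps on input `w` with proof `φ`. -/
def acceptProb (w : List Γ) {m : ℕ} (φ : (Fin m → Bool) → ℂ) (N : ℕ) : ℝ :=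
  V.haltProb w V.acc N V.initCfg (initVec V.k φ)

/-- Probability of rejection within `N` steps on input `w` with proof `φ`. -/
def rejectProb (w : List Γ) {m : ℕ} (φ : (Fin m → Bool) → ℂ) (N : ℕ) : ℝ :=
  V.haltProb w V.rej N V.initCfg (initVec V.k φ)

/-- `V` halts (surely) within `N` steps on input `w` with proof `φ`. -/
def HaltsWithin (w : List Γ) {m : ℕ} (φ : (Fin m → Bool) → ℂ) (N : ℕ) : Prop :=
  V.acceptProb w φ N + V.rejectProb w φ N = 1

end QuantumMachine

/-- The class `QMA`: promise problems with polynomial-time quantum verifiers. -/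
def QMA (Γ : Type) : Set (PromiseProblem Γ) :=
  {A | ∃ (V : QuantumVerifier Γ) (p : Polynomial ℕ),
    (∀ (w : List Γ) (m : ℕ) (φ : (Fin m → Bool) → ℂ), IsState φ →
      V.HaltsWithin w φ (p.eval w.length)) ∧
    (∀ w ∈ A.yes, ∃ (m : ℕ) (φ : (Fin m → Bool) → ℂ), IsState φ ∧
      2 / 3 ≤ V.acceptProb w φ (p.eval w.length)) ∧
    (∀ w ∈ A.no, ∀ (m : ℕ) (φ : (Fin m → Bool) → ℂ), IsState φ →
      2 / 3 ≤ V.rejectProb w φ (p.eval w.length))}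

/-- The empty proof (no qubits). -/
def noProof : (Fin 0 → Bool) → ℂ := fun _ => 1

/-- The class `BQTIME(t(n))`: promise problems solved with bounded error by stand-alone quantum
Turing machines (no proof qubits, finitely many classical work tapes) in time `t(n)`. -/
def BQTIME (Γ : Type) (t : ℕ → ℕ) : Set (PromiseProblem Γ) :=
  {A | ∃ (c : ℕ) (M : QuantumMachine Γ c),
    (∀ w : List Γ, M.HaltsWithin w noProof (t w.length)) ∧
    (∀ w ∈ A.yes, 2 / 3 ≤ M.acceptProb w noProof (t w.length)) ∧
    (∀ w ∈ A.no, 2 / 3 ≤ M.rejectProb w noProof (t w.length))}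

/-- The class `BQP`. -/
def BQP (Γ : Type) : Set (PromiseProblem Γ) :=
  {A | ∃ p : Polynomial ℕ, A ∈ BQTIME Γ fun n => p.eval n}

/-! ### Classical Merlin–Arthur systems -/

/-- The updates prescribed by a transition of a probabilistic verifier. -/
structure CUpdate (S K : Type) (c : ℕ) where
  state : S
  write : Fin c → K
  inDir : Dir
  certDir : Dir
  workDir : Fin c → Dir

/-- A probabilistic Turing machine with a read-only input tape, a read-only tape containing a
binary certificate, and `c` work tapes. It flips a fair coin in every step. -/
structure ProbVerifier (Γ : Type) (c : ℕ) where
  S : Type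
  K : Type
  [finS : Fintype S]
  [finK : Fintype K]
  blank : K
  δ : S → TapeSym Γ → TapeSym Bool → (Fin c → K) → Bool → CUpdate S K c
  s₀ : S
  acc : S
  rej : S
  acc_ne_rej : acc ≠ rej

attribute [instance] ProbVerifier.finS ProbVerifier.finK

namespace ProbVerifier

variable {Γ : Type} {c : ℕ} (V : ProbVerifier Γ c)

/-- Configurations. -/
structure Cfg where
  state : V.S
  inPos : ℕ
  certPos : ℕ
  work : Fin c → ℕ → V.K
  workPos : Fin c → ℕ

/-- Initial configuration. -/
def initCfg : V.Cfg where
  state := V.s₀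
  inPos := 0
  certPos := 0
  work := fun _ _ => V.blank
  workPos := fun _ => 0

variable {V}

/-- The transition for the coin value `b`. -/
def Cfg.upd (C : V.Cfg) (w : List Γ) (z : List Bool) (b : Bool) : CUpdate V.S V.K c :=
  V.δ C.state (tapeOf w C.inPos) (tapeOf z C.certPos) (fun i => C.work i (C.workPos i)) b

/-- The next configuration for the coin value `b`. -/
def Cfg.next (C : V.Cfg) (w : List Γ) (z : List Bool) (b : Bool) : V.Cfg where
  state := (C.upd w z b).state
  inPos := (C.upd w z b).inDir.moveOn w.length C.inPos
  certPos := (C.upd w z b).certDir.moveOn z.length C.certPos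
  work := fun i => Function.update (C.work i) (C.workPos i) ((C.upd w z b).write i)
  workPos := fun i => ((C.upd w z b).workDir i).move (C.workPos i)

variable (V)

open Classical in
/-- The probability with which `V`, started in configuration `C`, has halted in the state
`target` after at most `N` steps. -/
def haltProb (w : List Γ) (z : List Bool) (target : V.S) : ℕ → V.Cfg → ℝ
  | 0, C => if C.state = target then 1 else 0
  | N + 1, C =>
    if C.state = V.acc ∨ C.state = V.rej then
      if C.state = target then 1 else 0
    else
      (haltProb w z target N (C.next w z false) + haltProb w z target N (C.next w z true)) / 2

/-- Probability of acceptance within `N` steps on input `w` with certificate `z`. -/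
def acceptProb (w : List Γ) (z : List Bool) (N : ℕ) : ℝ := V.haltProb w z V.acc N V.initCfg

/-- Probability of rejection within `N` steps on input `w` with certificate `z`. -/
def rejectProb (w : List Γ) (z : List Bool) (N : ℕ) : ℝ := V.haltProb w z V.rej N V.initCfg

/-- `V` halts (surely) within `N` steps on input `w` with certificate `z`. -/
def HaltsWithin (w : List Γ) (z : List Bool) (N : ℕ) : Prop :=
  V.acceptProb w z N + V.rejectProb w z N = 1

end ProbVerifier

/-- The class `MATIME(t(n))`. A verifier running in time `t(n)` sees at most the first `t(n)`
certificate bits, so no separate bound on the length of certificates is needed. -/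
def MATIME (Γ : Type) (t : ℕ → ℕ) : Set (PromiseProblem Γ) :=
  {A | ∃ (c : ℕ) (V : ProbVerifier Γ c),
    (∀ (w : List Γ) (z : List Bool), V.HaltsWithin w z (t w.length)) ∧
    (∀ w ∈ A.yes, ∃ z : List Bool, 2 / 3 ≤ V.acceptProb w z (t w.length)) ∧
    (∀ w ∈ A.no, ∀ z : List Bool, 2 / 3 ≤ V.rejectProb w z (t w.length))}

/-- The class `MA`. -/
def MA (Γ : Type) : Set (PromiseProblem Γ) :=
  {A | ∃ p : Polynomial ℕ, A ∈ MATIME Γ fun n => p.eval n}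

/-! ### QMA-completeness and the exponential time hypothesis -/

/-- Polynomial-time (Karp) reducibility between promise problems. -/
def KarpReduces {Γ₁ Γ₂ : Type} (B : PromiseProblem Γ₁) (A : PromiseProblem Γ₂) : Prop :=
  ∃ f : List Γ₁ → List Γ₂,
    Nonempty (Turing.TM2ComputableInPolyTime (id : List Γ₁ → List Γ₁) (id : List Γ₂ → List Γ₂) f) ∧
    (∀ w ∈ B.yes, f w ∈ A.yes) ∧ (∀ w ∈ B.no, f w ∈ A.no)

/-- `QMA`-completeness under Karp reductions, where the problems in `QMA` may use any finite
alphabet. -/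
def QMAComplete {Γ : Type} (A : PromiseProblem Γ) : Prop :=
  A ∈ QMA Γ ∧ ∀ (Γ' : Type) [Finite Γ'], ∀ B ∈ QMA Γ', KarpReduces B A

/-- `t(n) ∈ 2^{n^{o(1)}}`. -/
def Subexponential (t : ℕ → ℕ) : Prop :=
  ∃ e : ℕ → ℝ, Tendsto e atTop (𝓝 0) ∧ ∀ᶠ n in atTop, (t n : ℝ) ≤ 2 ^ ((n : ℝ) ^ e n)

/-- The exponential time hypothesis for `QMA`-complete problems. -/
def ETHQMA : Prop :=
  ∀ t : ℕ → ℕ, Subexponential t → ∀ (Γ : Type) [Finite Γ] (A : PromiseProblem Γ),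
    QMAComplete A → A ∉ MATIME Γ t ∪ BQTIME Γ t

/-! ### The padded problems -/

/-- The shortest binary representation of `l`, most significant bit first; `bin 0` is the
one-symbol string `0`. -/
def bin (l : ℕ) : List Bool := if l = 0 then [false] else l.bits.reverse

/-- The alphabet `{0,1,$} × {0,1,#}` of two-track strings: `none` is the symbol `$` on the upper
track and the symbol `#` on the lower track. -/
abbrev PadSym : Type := Option Bool × Option Bool

/-- The string `bin(0)$bin(1)$⋯$bin(2^m - 1)`. -/
def upperTrack (m : ℕ) : List (Option Bool) :=
  List.intercalate [none] ((List.range (2 ^ m)).map fun l => (bin l).map some)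

/-- `x` is a padding of the binary string `w`. -/
def IsPadding (x : List PadSym) (w : List Bool) : Prop :=
  ∃ m : ℕ, 0 < m ∧ x.map Prod.fst = upperTrack m ∧
    x.map Prod.snd = w.map some ++ List.replicate ((upperTrack m).length - w.length) none ∧
    (w.length : ℝ) ≤ (2 : ℝ) ^ ((m : ℝ) / ((bin m).length : ℝ))

/-- The set of all paddings of members of `L`. -/
def pad (L : Set (List Bool)) : Set (List PadSym) := {x | ∃ w ∈ L, IsPadding x w}

theorem IsPadding.eq {x : List PadSym} {w w' : List Bool} (h : IsPadding x w)
    (h' : IsPadding x w') : w = w' := by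
  have key : ∀ {v : List Bool}, IsPadding x v → (x.map Prod.snd).reduceOption = v := by
    rintro v ⟨m, -, -, hv, -⟩
    rw [hv]
    simp [List.reduceOption, List.filterMap_append, List.filterMap_map]
  rw [← key h, ← key h']

/-- The padded version of a promise problem; strings that are not paddings are no-instances. -/
def padProblem (A : PromiseProblem Bool) : PromiseProblem PadSym where
  yes := pad A.yes
  no := pad A.no ∪ (pad Set.univ)ᶜ
  disjoint := by
    rw [Set.disjoint_left]
    rintro x ⟨w, hw, hx⟩ (⟨w', hw', hx'⟩ | hx')
    · exact Set.disjoint_left.mp A.disjoint hw (hx.eq hx' ▸ hw')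
    · exact hx' ⟨w, trivial, hx⟩

/-- The family of padded versions of `QMA`-complete problems over the binary alphabet. -/
def familyF : Set (PromiseProblem PadSym) :=
  {A' | ∃ A : PromiseProblem Bool, QMAComplete A ∧ A' = padProblem A}

end

end PaddedQMA

namespace PaddedQMA

open Filter Topology Matrix

/-! This is a padding argument. If the padded version of a QMA-complete problem `A` were in BQP or
MA, then `A` could be solved by writing down a padding of the input `w` and running the machine for
the padded problem on it. This takes time polynomial in the length of the padding, so ETH-QMA is
violated as soon as the padding has length `2^(n^o(1))`, where `n = |w|`.

Let `L` be the number of binary digits of `n` and put `m = 31 + L(L+1)/2`. Since `|bin(m)| = O(log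
L)`, one has `L * |bin(m)| ≤ m` (`mul_length_digits_marks_le`), so `n < 2^L ≤ 2^(m/|bin(m)|)` and a
padding with parameter `m` is legal. On the other hand `m = O(log² n)` (`exponent_le`), and `|u_m| ≤
2^m (m+1)`, so every polynomial in `|u_m|` is `2^O(log² n)`, which is of the form `2^(n^o(1))`
(`subexponential_of_le_two_pow`). A quadratic `m` is easy to generate: whenever a counter of the
input length gains a digit, one mark is added for each of its digits.

The rest is machine construction. An explicit deterministic stack machine writes the padding
(`padMachine.computes`). It is simulated on work tapes as a front end, and its output tape then
serves as the input tape of the given machine. The front end leaves qubits, proof and certificate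
alone and ignores coins, so halting probabilities carry over unchanged (`haltProb_attach`, in a
quantum and a probabilistic version). Step counts are exact throughout, which makes this an equality
and avoids any monotonicity in the number of steps. -/

/-! ### Timed runs of partial transition functions -/

/-- `b` is reached from `a` by exactly `n` applications of the partial function `f`. -/
def Steps {α : Type} (f : α → Option α) : ℕ → α → α → Prop
  | 0, a, b => a = b
  | n + 1, a, b => ∃ a', f a = some a' ∧ Steps f n a' b

namespace Steps

variable {α : Type} {f : α → Option α}

theorem head {n : ℕ} {a a' b : α} (h : f a = some a') (h' : Steps f n a' b) :
    Steps f (n + 1) a b := ⟨a', h, h'⟩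

theorem single {a b : α} (h : f a = some b) : Steps f 1 a b := ⟨b, h, rfl⟩

theorem trans {m n : ℕ} {a b c : α} (h : Steps f m a b) (h' : Steps f n b c) :
    Steps f (m + n) a c := by
  induction m generalizing a with
  | zero => cases h; simpa using h'
  | succ m ih =>
    obtain ⟨a', ha, h⟩ := h
    rw [Nat.add_right_comm]
    exact ⟨a', ha, ih h⟩

theorem cast {m n : ℕ} {a b : α} (h : Steps f m a b) (e : m = n) : Steps f n a b := e ▸ h

end Steps

/-! ### Stack machines -/

/-- Operations on a stack. -/
inductive StackOp (K : Type) where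
  | nop : StackOp K
  | pop : StackOp K
  | push (a : K) : StackOp K

namespace StackOp

variable {K : Type}

/-- The effect of an operation on a stack, whose top is the head of the list. -/
def apply : StackOp K → List K → List K
  | nop, l => l
  | pop, l => l.tail
  | push a, l => a :: l

/-- The head movement that realizes an operation on a tape. -/
def dir : StackOp K → Dir
  | nop => Dir.stay
  | pop => Dir.left
  | push _ => Dir.right

/-- The symbol to be written after the head movement. -/
def symbol : StackOp K → Option K
  | nop => none
  | pop => none
  | push a => some a

end StackOp

/-- A deterministic machine with a read-only input tape and `d` stacks. It halts where the
transition function is undefined. -/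
structure StackMachine (Γ K : Type) (d : ℕ) where
  S : Type
  [finS : Finite S]
  δ : S → TapeSym Γ → (Fin d → Option K) → Option (S × Dir × (Fin d → StackOp K))
  s₀ : S

attribute [instance] StackMachine.finS

namespace StackMachine

variable {Γ K : Type} {d : ℕ} (P : StackMachine Γ K d)

/-- Configurations of a stack machine. -/
@[ext]
structure Cfg where
  state : P.S
  inPos : ℕ
  stk : Fin d → List K

/-- The initial configuration: all stacks are empty. -/
def initCfg : P.Cfg := ⟨P.s₀, 0, fun _ => []⟩

/-- The transition prescribed in a configuration. -/
def trans (w : List Γ) (C : P.Cfg) : Option (P.S × Dir × (Fin d → StackOp K)) :=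
  P.δ C.state (tapeOf w C.inPos) fun i => (C.stk i).head?

/-- One step of a stack machine on input `w`. -/
def step (w : List Γ) (C : P.Cfg) : Option P.Cfg :=
  (P.trans w C).map fun u =>
    ⟨u.1, u.2.1.moveOn w.length C.inPos, fun i => (u.2.2 i).apply (C.stk i)⟩

/-! ### Stack machines as front ends of Turing machines -/

/-- States of a Turing machine simulating `P`: `read` looks at all tapes and moves the heads,
`write` writes the pushed symbols, `rewind` moves the head on the output tape to cell `0`. -/
inductive FrontState where
  | read (s : P.S) : FrontState
  | write (s : P.S) (a : Fin d → Option K) : FrontState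
  | rewind : FrontState

instance [Finite K] : Finite P.FrontState := by
  let g : P.FrontState → P.S ⊕ (P.S × (Fin d → Option K)) ⊕ Unit
    | .read s => .inl s
    | .write s a => .inr (.inl (s, a))
    | .rewind => .inr (.inr ())
  refine Finite.of_injective g ?_
  intro x y h
  cases x <;> cases y <;> simp_all [g]

/-- The updates prescribed by the front end; it is left when `state` is `none`. -/
structure FrontUpdate where
  state : Option P.FrontState
  write : Fin d → Option K
  inDir : Dir
  workDir : Fin d → Dir

/-- The transition function of the front end. The blank symbol `none` is found in cell `0` of
every tape, so a head scans it if and only if the corresponding stack is empty. -/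
def front (out : Fin d) (q : P.FrontState) (σ : TapeSym Γ) (a : Fin d → Option K) :
    P.FrontUpdate :=
  match q with
  | .read s =>
    match P.δ s σ a with
    | some u => ⟨some (.write u.1 fun i => (u.2.2 i).symbol), a, u.2.1, fun i => (u.2.2 i).dir⟩
    | none => ⟨some .rewind, a, .stay, fun _ => .stay⟩
  | .write s b => ⟨some (.read s), fun i => (b i).orElse fun _ => a i, .stay, fun _ => .stay⟩
  | .rewind =>
    match a out with
    | some _ => ⟨some .rewind, a, .stay, fun i => if i = out then .left else .stay⟩
    | none => ⟨none, a, .stay, fun _ => .stay⟩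

/-- Configurations of the front end. -/
@[ext]
structure FrontCfg where
  state : Option P.FrontState
  inPos : ℕ
  work : Fin d → ℕ → Option K
  workPos : Fin d → ℕ

/-- The initial configuration of the front end. -/
def initFrontCfg : P.FrontCfg := ⟨some (.read P.s₀), 0, fun _ _ => none, fun _ => 0⟩

variable {P}

/-- The transition of the front end from state `q` in a configuration. -/
def FrontCfg.upd (out : Fin d) (w : List Γ) (C : P.FrontCfg) (q : P.FrontState) :
    P.FrontUpdate :=
  P.front out q (tapeOf w C.inPos) fun i => C.work i (C.workPos i)

/-- The configuration following a transition of the front end. -/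
def FrontCfg.next (w : List Γ) (C : P.FrontCfg) (u : P.FrontUpdate) : P.FrontCfg where
  state := u.state
  inPos := u.inDir.moveOn w.length C.inPos
  work := fun i => Function.update (C.work i) (C.workPos i) (u.write i)
  workPos := fun i => (u.workDir i).move (C.workPos i)

/-- One step of the front end. -/
def FrontCfg.step (out : Fin d) (w : List Γ) (C : P.FrontCfg) : Option P.FrontCfg :=
  C.state.map fun q => C.next w (C.upd out w q)

/-! ### Correctness of the simulation of stacks by tapes -/

/-- The cells `0, …, l.length` of a tape contain a blank and the stack `l`, bottom first. -/
def Holds (t : ℕ → Option K) : List K → Prop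
  | [] => t 0 = none
  | a :: l => t (l.length + 1) = some a ∧ Holds t l

/-- Cells above the top of the stack are unconstrained, so symbols left behind by pops need not be
erased. -/
theorem Holds.congr {t t' : ℕ → Option K} {l : List K} (h : Holds t l)
    (e : ∀ i ≤ l.length, t' i = t i) : Holds t' l := by
  induction l with
  | nil => exact (e 0 le_rfl).trans h
  | cons a l ih =>
    exact ⟨(e _ le_rfl).trans h.1, ih h.2 fun i hi => e i (hi.trans (Nat.le_succ _))⟩

theorem Holds.scan {t : ℕ → Option K} {l : List K} (h : Holds t l) : t l.length = l.head? := by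
  cases l with
  | nil => exact h
  | cons a l => exact h.1

theorem Holds.zero {t : ℕ → Option K} {l : List K} (h : Holds t l) : t 0 = none := by
  induction l with
  | nil => exact h
  | cons a l ih => exact ih h.2

theorem Holds.get {t : ℕ → Option K} {l : List K} (h : Holds t l) {i : ℕ} (hi : i < l.length) :
    t (i + 1) = l.reverse[i]? := by
  induction l with
  | nil => simp at hi
  | cons a l ih =>
    rw [List.reverse_cons]
    rcases Nat.lt_succ_iff_lt_or_eq.mp hi with hi | rfl
    · rw [List.getElem?_append_left (by simpa using hi)]
      exact ih h.2 hi
    · rw [List.getElem?_append_right (by simp)]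
      simpa using h.1

/-- The front end is about to simulate the next step from a configuration of `P`. -/
structure Represents (F : P.FrontCfg) (C : P.Cfg) : Prop where
  state : F.state = some (.read C.state)
  inPos : F.inPos = C.inPos
  workPos : ∀ i, F.workPos i = (C.stk i).length
  work : ∀ i, Holds (F.work i) (C.stk i)

theorem represents_init : Represents P.initFrontCfg P.initCfg :=
  ⟨rfl, rfl, fun _ => rfl, fun _ => rfl⟩

theorem Represents.scan {F : P.FrontCfg} {C : P.Cfg} (h : Represents F C) :
    (fun i => F.work i (F.workPos i)) = fun i => (C.stk i).head? := by
  funext i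
  rw [h.workPos, (h.work i).scan]

theorem moveOn_stay_moveOn (d : Dir) (n i : ℕ) :
    Dir.stay.moveOn n (d.moveOn n i) = d.moveOn n i := by
  simp [Dir.moveOn, Dir.move]

theorem length_apply (o : StackOp K) (l : List K) :
    (o.apply l).length = o.dir.move l.length := by
  cases o <;> simp [StackOp.apply, StackOp.dir, Dir.move]

/-- The head moves before anything is written. A push then overwrites the cell above the old top,
whatever it contains; in the other cases the scanned symbol is written back. -/
theorem holds_apply (o : StackOp K) {t : ℕ → Option K} {l : List K} (h : Holds t l) :
    Holds (Function.update t (o.dir.move l.length)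
      (o.symbol.orElse fun _ => t (o.dir.move l.length))) (o.apply l) := by
  cases o with
  | nop => simpa [StackOp.symbol, StackOp.apply] using h
  | pop =>
    cases l with
    | nil => simpa [StackOp.symbol, StackOp.apply] using h
    | cons a l => simpa [StackOp.symbol, StackOp.apply] using h.2
  | push a =>
    refine ⟨by simp [StackOp.dir, StackOp.symbol, Dir.move], h.congr fun i hi => ?_⟩
    exact Function.update_of_ne (by simp only [StackOp.dir, Dir.move]; omega) _ _

/-- Two steps are needed because the transition depends on the old tops, whereas a pushed symbol
belongs in the cell reached only after the move. -/
theorem Represents.step {out : Fin d} {w : List Γ} {F : P.FrontCfg} {C C' : P.Cfg}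
    (h : Represents F C) (hC : P.step w C = some C') :
    ∃ F', Steps (FrontCfg.step out w) 2 F F' ∧ Represents F' C' := by
  obtain ⟨u, hu, rfl⟩ := Option.map_eq_some_iff.mp hC
  have h1 : F.upd out w (.read C.state) =
      ⟨some (.write u.1 fun i => (u.2.2 i).symbol), fun i => F.work i (F.workPos i), u.2.1,
        fun i => (u.2.2 i).dir⟩ := by
    simp only [trans] at hu
    simp only [FrontCfg.upd, front, h.scan, h.inPos, hu]
  have h2 : F.step out w = some (F.next w _) := (congrArg (Option.map _) h.state).trans
    (congrArg (fun u => some (F.next w u)) h1)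
  refine ⟨_, Steps.head h2 (Steps.single rfl), ?_⟩
  constructor
  · rfl
  · simp only [FrontCfg.next, FrontCfg.upd, front, h.inPos, moveOn_stay_moveOn]
  · intro i
    simp only [FrontCfg.next, FrontCfg.upd, front, Function.update_eq_self, h.workPos,
      length_apply]
    rfl
  · intro i
    simp only [FrontCfg.next, FrontCfg.upd, front, Function.update_eq_self, h.workPos]
    exact holds_apply _ (h.work i)

theorem Represents.steps {out : Fin d} {w : List Γ} {n : ℕ} {F : P.FrontCfg} {C C' : P.Cfg}
    (h : Represents F C) (hC : Steps (P.step w) n C C') :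
    ∃ F', Steps (FrontCfg.step out w) (2 * n) F F' ∧ Represents F' C' := by
  induction n generalizing F C with
  | zero => cases hC; exact ⟨F, rfl, h⟩
  | succ n ih =>
    obtain ⟨C₁, h1, h2⟩ := hC
    obtain ⟨F₁, s1, r1⟩ := h.step (out := out) h1
    obtain ⟨F₂, s2, r2⟩ := ih r1 h2
    exact ⟨F₂, (s1.trans s2).cast (by ring), r2⟩

/-- Cell `0` is the only blank cell among `0, …, j`, so the head stops exactly there; the additional
step is the one that notices the blank. -/
theorem steps_rewind {out : Fin d} {w : List Γ} {t : ℕ → Option K} (h0 : t 0 = none) {j : ℕ}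
    (hj : ∀ i < j, t (i + 1) ≠ none) (F : P.FrontCfg) (hs : F.state = some .rewind)
    (ht : F.work out = t) (hp : F.workPos out = j) :
    ∃ F', Steps (FrontCfg.step out w) (j + 1) F F' ∧ F'.state = none ∧
      F'.inPos ≤ w.length + 1 ∧ F'.work out = t ∧ F'.workPos out = 0 := by
  induction j generalizing F with
  | zero =>
    refine ⟨_, Steps.single (congrArg (Option.map _) hs), ?_⟩
    simp [FrontCfg.next, FrontCfg.upd, front, ht, hp, h0, Dir.moveOn, Dir.move]
  | succ j ih =>
    obtain ⟨a, ha⟩ := Option.ne_none_iff_exists'.mp (hj j (Nat.lt_succ_self j))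
    obtain ⟨F', s, h'⟩ := ih (fun i hi => hj i (Nat.lt_succ_of_lt hi))
      (F.next w (F.upd out w .rewind))
      (by simp [FrontCfg.next, FrontCfg.upd, front, ht, hp, ha])
      (by simp [FrontCfg.next, FrontCfg.upd, front, ht, hp, ha])
      (by simp [FrontCfg.next, FrontCfg.upd, front, ht, hp, ha, Dir.move])
    exact ⟨F', Steps.head (congrArg (Option.map _) hs) s, h'⟩

end StackMachine

/-! ### Using a work tape as a read-only input tape -/

/-- The symbol of the tape `▷ x ◁` encoded in a tape cell. -/
def cellSym {Γ : Type} : Option (Option Γ) → TapeSym Γ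
  | none => .leftEnd
  | some none => .rightEnd
  | some (some a) => .letter a

/-- Movement on an encoded tape `▷ x ◁`, given the scanned symbol. -/
def Dir.clamp {Γ : Type} (σ : TapeSym Γ) (d : Dir) : Dir :=
  match σ, d with
  | .rightEnd, .right => .stay
  | _, d => d

/-- The tape `t` contains an encoding of `▷ x ◁`. -/
def Encodes {Γ : Type} (t : ℕ → Option (Option Γ)) (x : List Γ) : Prop :=
  ∀ i ≤ x.length + 1, cellSym (t i) = tapeOf x i

/-- At the left end `Dir.move` already blocks the head. At the right end the scanned endmarker
reveals that a move to the right has to be suppressed, so the length of `x` need not be known. -/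
theorem Dir.move_clamp {Γ : Type} (x : List Γ) (d : Dir) {i : ℕ} (hi : i ≤ x.length + 1) :
    (d.clamp (tapeOf x i)).move i = d.moveOn x.length i := by
  cases d with
  | left => cases h : tapeOf x i <;> simp [Dir.clamp, Dir.moveOn, Dir.move] <;> omega
  | stay => cases h : tapeOf x i <;> simp [Dir.clamp, Dir.moveOn, Dir.move] <;> omega
  | right =>
    rcases Nat.lt_or_ge i (x.length + 1) with h | h
    · have : tapeOf x i ≠ .rightEnd := by
        cases i with
        | zero => simp [tapeOf]
        | succ i => simp [tapeOf, List.getElem?_eq_getElem (Nat.lt_of_succ_lt_succ h)]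
      have e : Dir.right.clamp (tapeOf x i) = Dir.right := by
        cases h : tapeOf x i <;> simp_all [Dir.clamp]
      simp [e, Dir.moveOn, Dir.move]; omega
    · obtain rfl : i = x.length + 1 := by omega
      simp [tapeOf, Dir.clamp, Dir.moveOn, Dir.move]

theorem Dir.moveOn_le (d : Dir) (n i : ℕ) : d.moveOn n i ≤ n + 1 := min_le_right _ _

namespace StackMachine

variable {Γ Γ' : Type} {d : ℕ}

/-- `P` computes `f` in exactly `T n` steps on inputs of length `n`: when it halts, the stack
`out` contains the result, bottom first, followed by the endmarker `none`. -/
def Computes (P : StackMachine Γ (Option Γ') d) (out : Fin d) (f : List Γ → List Γ')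
    (T : ℕ → ℕ) : Prop :=
  ∀ w, ∃ C, Steps (P.step w) (T w.length) P.initCfg C ∧ P.trans w C = none ∧
    C.stk out = none :: ((f w).map some).reverse

/-- The simulation takes `2 * T` steps, noticing that `P` has halted takes one, walking back from
the right endmarker takes `(f w).length + 1`, and recognizing cell `0` takes one. The blank in cell
`0` now plays the role of the left endmarker. -/
theorem Computes.front {P : StackMachine Γ (Option Γ') d} {out : Fin d}
    {f : List Γ → List Γ'} {T : ℕ → ℕ} (h : P.Computes out f T) (w : List Γ) :
    ∃ F, Steps (FrontCfg.step out w) (2 * T w.length + (f w).length + 3) P.initFrontCfg F ∧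
      F.state = none ∧ F.inPos ≤ w.length + 1 ∧ Encodes (F.work out) (f w) ∧
      F.workPos out = 0 := by
  obtain ⟨C, hs, hC, hout⟩ := h w
  obtain ⟨F, sF, hF⟩ := represents_init.steps (out := out) hs
  have hu : F.upd out w (.read C.state) = ⟨some .rewind, fun i => F.work i (F.workPos i), .stay,
      fun _ => .stay⟩ := by
    simp only [trans] at hC
    simp only [FrontCfg.upd, StackMachine.front, hF.scan, hF.inPos, hC]
  have hH := hF.work out
  have hp := hF.workPos out
  have hg : ∀ i < (f w).length + 1, F.work out (i + 1) = ((f w).map some ++ [none])[i]? := by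
    intro i hi
    rw [hH.get (by simpa [hout] using hi), hout]
    simp
  obtain ⟨F', sF', h1, h2, h3, h4⟩ := steps_rewind (out := out) (w := w) hH.zero
    (j := (f w).length + 1) (fun i hi => by
      rw [hg i hi, List.getElem?_eq_getElem (by simpa using hi)]; simp)
    (F.next w (F.upd out w (.read C.state))) (by rw [hu]; rfl)
    (by rw [hu]; simp [FrontCfg.next]) (by rw [hu]; simp [FrontCfg.next, Dir.move, hp, hout])
  refine ⟨F', ((sF.trans (Steps.head (congrArg (Option.map _) hF.state) sF'))).cast (by ring),
    h1, h2, fun i hi => ?_, h4⟩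
  rw [h3]
  cases i with
  | zero => rw [hH.zero]; rfl
  | succ i =>
    rw [hg i (by omega)]
    rcases Nat.lt_or_ge i (f w).length with h | h
    · rw [List.getElem?_append_left (by simpa using h)]
      simp [tapeOf, h, cellSym]
    · obtain rfl : i = (f w).length := by omega
      simp [tapeOf, cellSym]

end StackMachine

theorem ite_congr_of_iff {α : Sort*} {p q : Prop} {_ : Decidable p} {_ : Decidable q}
    {a b a' b' : α} (h : p ↔ q) (ha : a = a') (hb : b = b') :
    (if p then a else b) = if q then a' else b' := if_congr h ha hb

/-! ### Attaching a front end to a quantum Turing machine -/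

open Classical in
/-- The operation that leaves all qubits unchanged and has outcome `τ₀`. -/
noncomputable def SelectiveOp.idle {T : Type} [Fintype T] (k : ℕ) (τ₀ : T) : SelectiveOp T k where
  r := 1
  E := fun τ _ => if τ = τ₀ then 1 else 0
  complete := by
    rw [Finset.sum_eq_single τ₀]
    · simp
    · intro τ _ h
      simp [h]
    · simp
  algebraic := by
    intro τ i x y
    split_ifs
    · rw [Matrix.one_apply]
      split_ifs
      · exact isAlgebraic_one
      · exact isAlgebraic_zero
    · exact isAlgebraic_zero

/-- Every outcome except `τ₀` has the zero matrix as its operator and contributes nothing. -/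
theorem SelectiveOp.sum_of_eq_idle {T : Type} [Fintype T] {k : ℕ} {o : SelectiveOp T k} {τ₀ : T}
    (ho : o = idle k τ₀) {g : T → Matrix (LocalBasis k) (LocalBasis k) ℂ → ℝ}
    (hg : ∀ τ, g τ 0 = 0) : ∑ τ, ∑ i, g τ (o.E τ i) = g τ₀ 1 := by
  subst ho
  rw [Finset.sum_eq_single τ₀]
  · refine (Fin.sum_univ_one _).trans ?_
    simp [idle]
  · intro τ _ hτ
    simp [idle, hτ, hg]
  · simp

section

variable {k m : ℕ}

theorem applyLocal_one (h : ℕ) (ψ : QVec k m) : applyLocal 1 h ψ = ψ := by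
  conv_rhs => rw [← Finsupp.sum_single ψ]
  refine Finsupp.sum_congr fun x _ => ?_
  rw [Finset.sum_eq_single (x.1, x.2.1 h)]
  · simp
  · intro y _ hy
    simp [hy]
  · simp

theorem applyLocal_zero (h : ℕ) (ψ : QVec k m) : applyLocal 0 h ψ = 0 := by
  simp [applyLocal]

theorem applyLocal_zero_right (E : Matrix (LocalBasis k) (LocalBasis k) ℂ) (h : ℕ) :
    applyLocal E h (0 : QVec k m) = 0 := by
  simp [applyLocal]

end

namespace QuantumMachine

section

variable {Γ : Type} {c : ℕ} (V : QuantumMachine Γ c)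

theorem haltProb_zero_vec (w : List Γ) {m : ℕ} (target : V.S) (N : ℕ) (C : V.Cfg) :
    V.haltProb w (m := m) target N C 0 = 0 := by
  induction N generalizing C with
  | zero => simp [haltProb, normSq]
  | succ N ih =>
    rw [haltProb]
    split_ifs
    · simp [normSq]
    · rfl
    · refine Finset.sum_eq_zero fun τ _ => Finset.sum_eq_zero fun i _ => ?_
      rw [applyLocal_zero_right]
      have : C.readProof w τ (0 : QVec V.k m) = 0 := by
        unfold Cfg.readProof
        split_ifs
        · simp [swapProof]
        · rfl
      rw [this, ih]

end

variable {Γ Γ' : Type} [Finite Γ'] {c d : ℕ}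

/-- The machine `M` preceded by the front end given by `P`: the tape `out` of the front end
serves as the input tape of `M`. -/
noncomputable abbrev attach (M : QuantumMachine Γ' c) (P : StackMachine Γ (Option Γ') d)
    (out : Fin d) : QuantumMachine Γ (d + c) where
  S := P.FrontState ⊕ M.S
  -- One alphabet has to serve all tapes: the tapes of the front end use the first component, those
  -- of `M` the second.
  K := Option (Option Γ') × M.K
  T := M.T
  finS := Fintype.ofFinite _
  finK := Fintype.ofFinite _
  k := M.k
  k_pos := M.k_pos
  blank := (none, M.blank)
  δ₁ := fun s _ a =>
    match s with
    | .inl _ => SelectiveOp.idle M.k M.τ₀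
    | .inr s => M.δ₁ s (cellSym (a (Fin.castAdd c out)).1) fun j => (a (Fin.natAdd d j)).2
  δ₂ := fun s σ a τ =>
    match s with
    | .inl q =>
      let u := P.front out q σ fun i => (a (Fin.castAdd c i)).1
      { state := u.state.elim (.inr M.s₀) .inl
        write := Fin.addCases (fun i => (u.write i, (a (Fin.castAdd c i)).2))
          fun j => a (Fin.natAdd d j)
        inDir := u.inDir
        workDir := Fin.addCases u.workDir fun _ => .stay
        qDir := .stay
        readProof := false }
    | .inr s =>
      let σ := cellSym (a (Fin.castAdd c out)).1
      let u := M.δ₂ s σ (fun j => (a (Fin.natAdd d j)).2) τ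
      { state := .inr u.state
        write := Fin.addCases (fun i => a (Fin.castAdd c i))
          fun j => ((a (Fin.natAdd d j)).1, u.write j)
        inDir := .stay
        workDir := Fin.addCases (fun i => if i = out then u.inDir.clamp σ else .stay) u.workDir
        qDir := u.qDir
        readProof := u.readProof }
  s₀ := .inl (.read P.s₀)
  τ₀ := M.τ₀
  acc := .inr M.acc
  rej := .inr M.rej
  acc_ne_rej := fun h => M.acc_ne_rej (Sum.inr.inj h)

variable {M : QuantumMachine Γ' c} {P : StackMachine Γ (Option Γ') d} {out : Fin d}

/-- A configuration of the front end as a configuration of the whole machine. -/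
noncomputable def frontCfg (M : QuantumMachine Γ' c) {P : StackMachine Γ (Option Γ') d}
    (out : Fin d) (F : P.FrontCfg) : (M.attach P out).Cfg where
  state := F.state.elim (.inr M.s₀) .inl
  meas := M.τ₀
  inPos := F.inPos
  work := Fin.addCases (fun i n => (F.work i n, M.blank)) fun _ _ => (none, M.blank)
  workPos := Fin.addCases F.workPos fun _ => 0
  qPos := 0
  proofPos := 0

/-- A configuration of `M` as a configuration of the whole machine, when the front end has
finished in configuration `F`. -/
noncomputable def mainCfg {P : StackMachine Γ (Option Γ') d} (out : Fin d) (F : P.FrontCfg)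
    (C : M.Cfg) : (M.attach P out).Cfg where
  state := .inr C.state
  meas := C.meas
  inPos := F.inPos
  work := Fin.addCases (fun i n => (F.work i n, M.blank)) fun j n => (none, C.work j n)
  workPos := Fin.addCases (fun i => if i = out then C.inPos else F.workPos i) C.workPos
  qPos := C.qPos
  proofPos := C.proofPos

theorem initCfg_attach : (M.attach P out).initCfg = frontCfg M out P.initFrontCfg := by
  unfold initCfg frontCfg
  congr 1
  · funext i
    refine Fin.addCases (fun i => ?_) (fun j => ?_) i <;> simp [StackMachine.initFrontCfg]
  · funext i
    refine Fin.addCases (fun i => ?_) (fun j => ?_) i <;> simp [StackMachine.initFrontCfg]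

theorem frontCfg_eq_mainCfg {F : P.FrontCfg} (hs : F.state = none) (hp : F.workPos out = 0) :
    frontCfg M out F = mainCfg out F M.initCfg := by
  unfold frontCfg mainCfg initCfg
  congr 1
  · rw [hs]; rfl
  · funext i
    refine Fin.addCases (fun i => ?_) (fun j => ?_) i
    · by_cases h : i = out
      · simp [h, hp]
      · simp [h]
    · simp

theorem frontCfg_next {w : List Γ} {m : ℕ} {F F' : P.FrontCfg}
    (h : StackMachine.FrontCfg.step out w F = some F') :
    (frontCfg M out F).next w m M.τ₀ = frontCfg M out F' := by
  obtain ⟨q, hq, rfl⟩ := Option.map_eq_some_iff.mp h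
  have e : (frontCfg M out F).upd w M.τ₀ =
      (M.attach P out).δ₂ (.inl q) (tapeOf w F.inPos) (frontCfg M out F).scan M.τ₀ := by
    simp [Cfg.upd, frontCfg, hq]
  have hscan : (fun i => ((frontCfg M out F).scan (Fin.castAdd c i)).1) =
      fun i => F.work i (F.workPos i) := by
    funext i
    simp [Cfg.scan, frontCfg]
  unfold Cfg.next
  rw [e]
  simp only [attach, hscan]
  unfold frontCfg
  congr 1
  · funext i
    refine Fin.addCases (fun i => ?_) (fun j => ?_) i
    · funext n
      simp only [Fin.addCases_left, Function.update_apply, Cfg.scan,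
        StackMachine.FrontCfg.next, StackMachine.FrontCfg.upd]
      split_ifs <;> rfl
    · funext n
      simp [Cfg.scan]
  · funext i
    refine Fin.addCases (fun i => ?_) (fun j => ?_) i
    · simp [StackMachine.FrontCfg.next, StackMachine.FrontCfg.upd]
    · simp [Dir.move]

/-- The idle operation turns the sum over outcomes into a single branch. Its outcome is `M.τ₀`, so
the recorded outcome still agrees with the initial configuration of `M` when control is handed over.
-/
theorem haltProb_front_step {w : List Γ} {m : ℕ} {F F' : P.FrontCfg}
    (h : StackMachine.FrontCfg.step out w F = some F') (t : M.S) (N : ℕ) (ψ : QVec M.k m) :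
    (M.attach P out).haltProb w (.inr t) (N + 1) (frontCfg M out F) ψ =
      (M.attach P out).haltProb w (.inr t) N (frontCfg M out F') ψ := by
  obtain ⟨q, hq, -⟩ := Option.map_eq_some_iff.mp h
  have hst : (frontCfg M out F).state = .inl q := by simp [frontCfg, hq]
  have hop : (frontCfg M out F).op w = SelectiveOp.idle M.k M.τ₀ := by
    simp only [Cfg.op, hst]
  have hrp : ∀ (τ : M.T) (χ : QVec M.k m), (frontCfg M out F).readProof w τ χ = χ := by
    intro τ χ
    have : ((frontCfg M out F).upd w τ).readProof = false := by
      simp only [Cfg.upd, hst]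
    exact dif_neg (by simp [this])
  rw [haltProb, if_neg (by rw [hst]; simp [attach])]
  simp only [hrp]
  refine (SelectiveOp.sum_of_eq_idle hop (g := fun τ E => (M.attach P out).haltProb w (.inr t) N
    ((frontCfg M out F).next w m τ) (applyLocal E (frontCfg M out F).qPos ψ)) fun τ => ?_).trans ?_
  · rw [applyLocal_zero]
    exact haltProb_zero_vec ..
  · simp only [applyLocal_one, frontCfg_next h]

theorem haltProb_front {w : List Γ} {m n : ℕ} {F F' : P.FrontCfg}
    (h : Steps (StackMachine.FrontCfg.step out w) n F F') (t : M.S) (N : ℕ) (ψ : QVec M.k m) :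
    (M.attach P out).haltProb w (.inr t) (n + N) (frontCfg M out F) ψ =
      (M.attach P out).haltProb w (.inr t) N (frontCfg M out F') ψ := by
  induction n generalizing F with
  | zero => cases h; rw [Nat.zero_add]
  | succ n ih =>
    obtain ⟨F₁, h1, h2⟩ := h
    rw [Nat.add_right_comm, haltProb_front_step h1, ih h2]

section

variable {w : List Γ} {x : List Γ'} {F : P.FrontCfg} (hx : Encodes (F.work out) x)
  (hF : F.inPos ≤ w.length + 1) {C : M.Cfg} (hC : C.inPos ≤ x.length + 1)
include hx hC

theorem mainCfg_op : (mainCfg out F C).op w = C.op x := by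
  have h : (fun j => ((mainCfg out F C).scan (Fin.natAdd d j)).2) = C.scan := by
    funext j
    simp [Cfg.scan, mainCfg]
  have h' : cellSym ((mainCfg out F C).scan (Fin.castAdd c out)).1 = tapeOf x C.inPos := by
    rw [← hx _ hC]
    simp [Cfg.scan, mainCfg]
  simp only [Cfg.op]
  rw [← h, ← h']
  rfl

theorem mainCfg_upd (τ : M.T) : (mainCfg out F C).upd w τ =
    { state := .inr (C.upd x τ).state
      write := Fin.addCases (fun i => (mainCfg out F C).scan (Fin.castAdd c i))
          fun j => (none, (C.upd x τ).write j)
      inDir := .stay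
      workDir := Fin.addCases (fun i => if i = out then
        (C.upd x τ).inDir.clamp (tapeOf x C.inPos) else .stay) (C.upd x τ).workDir
      qDir := (C.upd x τ).qDir
      readProof := (C.upd x τ).readProof } := by
  have h : (fun j => ((mainCfg out F C).scan (Fin.natAdd d j)).2) = C.scan := by
    funext j
    simp [Cfg.scan, mainCfg]
  have h' : cellSym ((mainCfg out F C).scan (Fin.castAdd c out)).1 = tapeOf x C.inPos := by
    rw [← hx _ hC]
    simp [Cfg.scan, mainCfg]
  have h2 : ∀ j, ((mainCfg out F C).scan (Fin.natAdd d j)).1 = none := by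
    intro j
    simp [Cfg.scan, mainCfg]
  have e : (mainCfg out F C).upd w τ =
      (M.attach P out).δ₂ (.inr C.state) (tapeOf w F.inPos) (mainCfg out F C).scan τ := rfl
  rw [e]
  simp only [attach, h, h', h2]
  rfl

include hF

/-- The real input head rests during this phase. Since `moveOn` truncates the position even when the
head stays, the bound on `F.inPos` is what keeps it fixed. -/
theorem mainCfg_next (m : ℕ) (τ : M.T) :
    (mainCfg out F C).next w m τ = mainCfg out F (C.next x m τ) := by
  unfold Cfg.next
  rw [mainCfg_upd hx hC]
  unfold mainCfg
  congr 1
  · simpa [Dir.moveOn, Dir.move] using hF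
  · funext i
    refine Fin.addCases (fun i => ?_) (fun j => ?_) i
    · simp [Cfg.scan]
    · funext n
      simp only [Fin.addCases_right, Function.update_apply]
      split_ifs <;> rfl
  · funext i
    refine Fin.addCases (fun i => ?_) (fun j => ?_) i
    · by_cases h : i = out
      · simp [h, Dir.move_clamp x _ hC]
      · simp [h, Dir.move]
    · simp

/-- The two machines run in lockstep. The bound on `C.inPos` is carried through the induction
because the tape is known to encode `x` only up to the right endmarker. -/
theorem haltProb_main (t : M.S) (N : ℕ) {m : ℕ} (ψ : QVec M.k m) :
    (M.attach P out).haltProb w (.inr t) N (mainCfg out F C) ψ = M.haltProb x t N C ψ := by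
  induction N generalizing C ψ with
  | zero =>
    simp only [haltProb]
    refine ite_congr_of_iff ⟨fun h => Sum.inr.inj h, fun h => congrArg Sum.inr h⟩ rfl rfl
  | succ N ih =>
    have hi : ∀ s, (mainCfg out F C).state = .inr s ↔ C.state = s := fun s =>
      ⟨fun h => Sum.inr.inj h, fun h => congrArg Sum.inr h⟩
    rw [haltProb, haltProb]
    refine ite_congr_of_iff (or_congr (hi _) (hi _)) (ite_congr_of_iff (hi _) rfl rfl) ?_
    rw [mainCfg_op hx hC]
    refine Finset.sum_congr rfl fun τ _ => Finset.sum_congr rfl fun i _ => ?_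
    rw [mainCfg_next hx hF hC]
    refine (ih (Dir.moveOn_le _ _ _) _).trans ?_
    congr 1
    have e := congrArg QUpdate.readProof (mainCfg_upd (P := P) (w := w) hx hC τ)
    simp only [Cfg.readProof, e]
    rfl

end

theorem haltProb_attach {f : List Γ → List Γ'} {T : ℕ → ℕ} (hP : P.Computes out f T)
    (w : List Γ) (t : M.S) (N : ℕ) {m : ℕ} (ψ : QVec M.k m) :
    (M.attach P out).haltProb w (.inr t) (2 * T w.length + (f w).length + 3 + N)
      (M.attach P out).initCfg ψ = M.haltProb (f w) t N M.initCfg ψ := by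
  obtain ⟨F, hs, h1, h2, h3, h4⟩ := hP.front w
  rw [initCfg_attach, haltProb_front hs, frontCfg_eq_mainCfg h1 h4,
    haltProb_main h3 h2 (Nat.zero_le _)]

end QuantumMachine

/-- The length of `f w` depends only on that of `w`, which makes the total time a function of the
input length alone. -/
theorem BQTIME_of_computes {Γ Γ' : Type} [Finite Γ'] {d : ℕ} {P : StackMachine Γ (Option Γ') d}
    {out : Fin d} {f : List Γ → List Γ'} {T ℓ t : ℕ → ℕ} (hP : P.Computes out f T)
    (hℓ : ∀ w, (f w).length = ℓ w.length) {A : PromiseProblem Γ} {A' : PromiseProblem Γ'}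
    (hyes : ∀ w ∈ A.yes, f w ∈ A'.yes) (hno : ∀ w ∈ A.no, f w ∈ A'.no)
    (hA' : A' ∈ BQTIME Γ' t) :
    A ∈ BQTIME Γ fun n => 2 * T n + ℓ n + 3 + t (ℓ n) := by
  obtain ⟨c, M, h1, h2, h3⟩ := hA'
  have key : ∀ (w : List Γ) (s : M.S), (M.attach P out).haltProb w (.inr s)
      (2 * T w.length + ℓ w.length + 3 + t (ℓ w.length)) (M.attach P out).initCfg
      (initVec M.k noProof) =
        M.haltProb (f w) s (t (f w).length) M.initCfg (initVec M.k noProof) := by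
    intro w s
    rw [← hℓ, QuantumMachine.haltProb_attach hP]
  refine ⟨_, M.attach P out, fun w => ?_, fun w hw => ?_, fun w hw => ?_⟩
  · exact (congrArg₂ (· + ·) (key w M.acc) (key w M.rej)).trans (h1 (f w))
  · exact (h2 _ (hyes w hw)).trans_eq (key w M.acc).symm
  · exact (h3 _ (hno w hw)).trans_eq (key w M.rej).symm

/-! ### Attaching a front end to a probabilistic verifier -/

namespace ProbVerifier

variable {Γ Γ' : Type} [Finite Γ'] {c d : ℕ}

/-- The verifier `M` preceded by the front end given by `P`: the tape `out` of the front end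
serves as the input tape of `M`. -/
noncomputable abbrev attach (M : ProbVerifier Γ' c) (P : StackMachine Γ (Option Γ') d)
    (out : Fin d) : ProbVerifier Γ (d + c) where
  S := P.FrontState ⊕ M.S
  K := Option (Option Γ') × M.K
  finS := Fintype.ofFinite _
  finK := Fintype.ofFinite _
  blank := (none, M.blank)
  δ := fun s σ ζ a b =>
    match s with
    | .inl q =>
      let u := P.front out q σ fun i => (a (Fin.castAdd c i)).1
      { state := u.state.elim (.inr M.s₀) .inl
        write := Fin.addCases (fun i => (u.write i, (a (Fin.castAdd c i)).2))
          fun j => a (Fin.natAdd d j)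
        inDir := u.inDir
        certDir := .stay
        workDir := Fin.addCases u.workDir fun _ => .stay }
    | .inr s =>
      let σ := cellSym (a (Fin.castAdd c out)).1
      let u := M.δ s σ ζ (fun j => (a (Fin.natAdd d j)).2) b
      { state := .inr u.state
        write := Fin.addCases (fun i => a (Fin.castAdd c i))
          fun j => ((a (Fin.natAdd d j)).1, u.write j)
        inDir := .stay
        certDir := u.certDir
        workDir := Fin.addCases (fun i => if i = out then u.inDir.clamp σ else .stay) u.workDir }
  s₀ := .inl (.read P.s₀)
  acc := .inr M.acc
  rej := .inr M.rej
  acc_ne_rej := fun h => M.acc_ne_rej (Sum.inr.inj h)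

variable {M : ProbVerifier Γ' c} {P : StackMachine Γ (Option Γ') d} {out : Fin d}

/-- A configuration of the front end as a configuration of the whole machine. -/
noncomputable def frontCfg (M : ProbVerifier Γ' c) {P : StackMachine Γ (Option Γ') d}
    (out : Fin d) (F : P.FrontCfg) : (M.attach P out).Cfg where
  state := F.state.elim (.inr M.s₀) .inl
  inPos := F.inPos
  certPos := 0
  work := Fin.addCases (fun i n => (F.work i n, M.blank)) fun _ _ => (none, M.blank)
  workPos := Fin.addCases F.workPos fun _ => 0

/-- A configuration of `M` as a configuration of the whole machine, when the front end has
finished in configuration `F`. -/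
noncomputable def mainCfg {P : StackMachine Γ (Option Γ') d} (out : Fin d) (F : P.FrontCfg)
    (C : M.Cfg) : (M.attach P out).Cfg where
  state := .inr C.state
  inPos := F.inPos
  certPos := C.certPos
  work := Fin.addCases (fun i n => (F.work i n, M.blank)) fun j n => (none, C.work j n)
  workPos := Fin.addCases (fun i => if i = out then C.inPos else F.workPos i) C.workPos

theorem initCfg_attach : (M.attach P out).initCfg = frontCfg M out P.initFrontCfg := by
  unfold initCfg frontCfg
  congr 1
  · funext i
    refine Fin.addCases (fun i => ?_) (fun j => ?_) i <;> simp [StackMachine.initFrontCfg]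
  · funext i
    refine Fin.addCases (fun i => ?_) (fun j => ?_) i <;> simp [StackMachine.initFrontCfg]

theorem frontCfg_eq_mainCfg {F : P.FrontCfg} (hs : F.state = none) (hp : F.workPos out = 0) :
    frontCfg M out F = mainCfg out F M.initCfg := by
  unfold frontCfg mainCfg initCfg
  congr 1
  · rw [hs]; rfl
  · funext i
    refine Fin.addCases (fun i => ?_) (fun j => ?_) i
    · by_cases h : i = out
      · simp [h, hp]
      · simp [h]
    · simp

theorem frontCfg_next {w : List Γ} {z : List Bool} {F F' : P.FrontCfg} {b : Bool}
    (h : StackMachine.FrontCfg.step out w F = some F') :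
    (frontCfg M out F).next w z b = frontCfg M out F' := by
  obtain ⟨q, hq, rfl⟩ := Option.map_eq_some_iff.mp h
  have e : (frontCfg M out F).upd w z b = (M.attach P out).δ (.inl q) (tapeOf w F.inPos)
      (tapeOf z 0) (fun i => (frontCfg M out F).work i ((frontCfg M out F).workPos i)) b := by
    simp [Cfg.upd, frontCfg, hq]
  have hscan : (fun i => ((frontCfg M out F).work (Fin.castAdd c i)
      ((frontCfg M out F).workPos (Fin.castAdd c i))).1) = fun i => F.work i (F.workPos i) := by
    funext i
    simp [frontCfg]
  unfold Cfg.next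
  rw [e]
  simp only [attach, hscan]
  unfold frontCfg
  congr 1
  · funext i
    refine Fin.addCases (fun i => ?_) (fun j => ?_) i
    · funext n
      simp only [Fin.addCases_left, Function.update_apply,
        StackMachine.FrontCfg.next, StackMachine.FrontCfg.upd]
      split_ifs <;> rfl
    · funext n
      simp
  · funext i
    refine Fin.addCases (fun i => ?_) (fun j => ?_) i
    · simp [StackMachine.FrontCfg.next, StackMachine.FrontCfg.upd]
    · simp [Dir.move]

theorem haltProb_front {w : List Γ} {z : List Bool} {n : ℕ} {F F' : P.FrontCfg}
    (h : Steps (StackMachine.FrontCfg.step out w) n F F') (t : M.S) (N : ℕ) :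
    (M.attach P out).haltProb w z (.inr t) (n + N) (frontCfg M out F) =
      (M.attach P out).haltProb w z (.inr t) N (frontCfg M out F') := by
  induction n generalizing F with
  | zero => cases h; rw [Nat.zero_add]
  | succ n ih =>
    obtain ⟨F₁, h1, h2⟩ := h
    obtain ⟨q, hq, -⟩ := Option.map_eq_some_iff.mp h1
    have hst : (frontCfg M out F).state = .inl q := by simp [frontCfg, hq]
    -- Both values of the coin lead to the same configuration, so the average collapses.
    rw [Nat.add_right_comm, haltProb, if_neg (by rw [hst]; simp [attach]), frontCfg_next h1,
      frontCfg_next h1, add_self_div_two, ih h2]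

section

variable {w : List Γ} {x : List Γ'} {F : P.FrontCfg} (hx : Encodes (F.work out) x)
  (hF : F.inPos ≤ w.length + 1) {C : M.Cfg} (hC : C.inPos ≤ x.length + 1)
include hx hC

theorem mainCfg_upd (z : List Bool) (b : Bool) : (mainCfg out F C).upd w z b =
    { state := .inr (C.upd x z b).state
      write := Fin.addCases (fun i => (mainCfg out F C).work (Fin.castAdd c i)
        ((mainCfg out F C).workPos (Fin.castAdd c i))) fun j => (none, (C.upd x z b).write j)
      inDir := .stay
      certDir := (C.upd x z b).certDir
      workDir := Fin.addCases (fun i => if i = out then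
        (C.upd x z b).inDir.clamp (tapeOf x C.inPos) else .stay) (C.upd x z b).workDir } := by
  have h : (fun j => ((mainCfg out F C).work (Fin.natAdd d j)
      ((mainCfg out F C).workPos (Fin.natAdd d j))).2) = fun j => C.work j (C.workPos j) := by
    funext j
    simp [mainCfg]
  have h' : cellSym ((mainCfg out F C).work (Fin.castAdd c out)
      ((mainCfg out F C).workPos (Fin.castAdd c out))).1 = tapeOf x C.inPos := by
    rw [← hx _ hC]
    simp [mainCfg]
  have h2 : ∀ j, ((mainCfg out F C).work (Fin.natAdd d j)
      ((mainCfg out F C).workPos (Fin.natAdd d j))).1 = none := by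
    intro j
    simp [mainCfg]
  have e : (mainCfg out F C).upd w z b =
      (M.attach P out).δ (.inr C.state) (tapeOf w F.inPos) (tapeOf z C.certPos)
        (fun i => (mainCfg out F C).work i ((mainCfg out F C).workPos i)) b := rfl
  rw [e]
  simp only [attach, h, h', h2]
  rfl

include hF

theorem mainCfg_next (z : List Bool) (b : Bool) :
    (mainCfg out F C).next w z b = mainCfg out F (C.next x z b) := by
  unfold Cfg.next
  rw [mainCfg_upd hx hC]
  unfold mainCfg
  congr 1
  · simpa [Dir.moveOn, Dir.move] using hF
  · funext i
    refine Fin.addCases (fun i => ?_) (fun j => ?_) i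
    · simp
    · funext n
      simp only [Fin.addCases_right, Function.update_apply]
      split_ifs <;> rfl
  · funext i
    refine Fin.addCases (fun i => ?_) (fun j => ?_) i
    · by_cases h : i = out
      · simp [h, Dir.move_clamp x _ hC]
      · simp [h, Dir.move]
    · simp

theorem haltProb_main (z : List Bool) (t : M.S) (N : ℕ) :
    (M.attach P out).haltProb w z (.inr t) N (mainCfg out F C) = M.haltProb x z t N C := by
  induction N generalizing C with
  | zero =>
    simp only [haltProb]
    refine ite_congr_of_iff ⟨fun h => Sum.inr.inj h, fun h => congrArg Sum.inr h⟩ rfl rfl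
  | succ N ih =>
    have hi : ∀ s, (mainCfg out F C).state = .inr s ↔ C.state = s := fun s =>
      ⟨fun h => Sum.inr.inj h, fun h => congrArg Sum.inr h⟩
    rw [haltProb, haltProb]
    refine ite_congr_of_iff (or_congr (hi _) (hi _)) (ite_congr_of_iff (hi _) rfl rfl) ?_
    rw [mainCfg_next hx hF hC, mainCfg_next hx hF hC, ih (Dir.moveOn_le _ _ _),
      ih (Dir.moveOn_le _ _ _)]

end

theorem haltProb_attach {f : List Γ → List Γ'} {T : ℕ → ℕ} (hP : P.Computes out f T)
    (w : List Γ) (z : List Bool) (t : M.S) (N : ℕ) :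
    (M.attach P out).haltProb w z (.inr t) (2 * T w.length + (f w).length + 3 + N)
      (M.attach P out).initCfg = M.haltProb (f w) z t N M.initCfg := by
  obtain ⟨F, hs, h1, h2, h3, h4⟩ := hP.front w
  rw [initCfg_attach, haltProb_front hs, frontCfg_eq_mainCfg h1 h4,
    haltProb_main h3 h2 (Nat.zero_le _)]

end ProbVerifier

theorem MATIME_of_computes {Γ Γ' : Type} [Finite Γ'] {d : ℕ} {P : StackMachine Γ (Option Γ') d}
    {out : Fin d} {f : List Γ → List Γ'} {T ℓ t : ℕ → ℕ} (hP : P.Computes out f T)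
    (hℓ : ∀ w, (f w).length = ℓ w.length) {A : PromiseProblem Γ} {A' : PromiseProblem Γ'}
    (hyes : ∀ w ∈ A.yes, f w ∈ A'.yes) (hno : ∀ w ∈ A.no, f w ∈ A'.no)
    (hA' : A' ∈ MATIME Γ' t) :
    A ∈ MATIME Γ fun n => 2 * T n + ℓ n + 3 + t (ℓ n) := by
  obtain ⟨c, M, h1, h2, h3⟩ := hA'
  have key : ∀ (w : List Γ) (z : List Bool) (s : M.S), (M.attach P out).haltProb w z (.inr s)
      (2 * T w.length + ℓ w.length + 3 + t (ℓ w.length)) (M.attach P out).initCfg =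
        M.haltProb (f w) z s (t (f w).length) M.initCfg := by
    intro w z s
    rw [← hℓ, ProbVerifier.haltProb_attach hP]
  refine ⟨_, M.attach P out, fun w z => ?_, fun w hw => ?_, fun w hw z => ?_⟩
  · exact (congrArg₂ (· + ·) (key w z M.acc) (key w z M.rej)).trans (h1 (f w) z)
  · obtain ⟨z, hz⟩ := h2 _ (hyes w hw)
    exact ⟨z, hz.trans_eq (key w z M.acc).symm⟩
  · exact (h3 _ (hno w hw) z).trans_eq (key w z M.rej).symm

/-! ### Binary counters -/

/-- The digits of the shortest binary representation, least significant digit first. -/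
def digits (l : ℕ) : List Bool := if l = 0 then [false] else l.bits

theorem bin_eq (l : ℕ) : bin l = (digits l).reverse := by
  unfold bin digits
  split_ifs <;> rfl

/-- Increment of a binary number, least significant digit first. -/
def increment : List Bool → List Bool
  | [] => [true]
  | false :: l => true :: l
  | true :: l => false :: increment l

/-- An even number only changes its last digit. For `l = 2k + 1` the successor is `2(k + 1)`, so the
carry is the increment of `k`. The case `k = 0` is separate because `digits 0` is not `Nat.bits 0`.
-/
theorem digits_succ (l : ℕ) : digits (l + 1) = increment (digits l) := by
  induction l using Nat.strong_induction_on with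
  | _ l ih =>
    rcases Nat.even_or_odd' l with ⟨k, rfl | rfl⟩
    · rcases Nat.eq_zero_or_pos k with rfl | hk
      · simp [digits, increment]
      · rw [digits, digits, if_neg (by omega), if_neg (by omega), Nat.bit1_bits,
          Nat.bit0_bits k (by omega), increment]
    · rcases Nat.eq_zero_or_pos k with rfl | hk
      · rw [digits, digits, if_neg (by omega), if_neg (by omega), Nat.bit1_bits,
          show 2 * 0 + 1 + 1 = 2 * 1 by rfl, Nat.bit0_bits 1 (by omega)]
        simp [increment]
      · have := ih k (by omega)
        rw [digits, digits, if_neg (by omega), if_neg (by omega)] at this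
        rw [digits, digits, if_neg (by omega), if_neg (by omega), Nat.bit1_bits,
          show 2 * k + 1 + 1 = 2 * (k + 1) by ring, Nat.bit0_bits _ (by omega), increment, this]

theorem length_increment_of_mem {l : List Bool} (h : false ∈ l) :
    (increment l).length = l.length := by
  induction l with
  | nil => simp at h
  | cons b l ih => cases b <;> simp_all [increment]

theorem eq_replicate_of_not_mem {l : List Bool} (h : false ∉ l) :
    l = List.replicate l.length true :=
  List.eq_replicate_of_mem fun b hb => by cases b <;> simp_all

theorem increment_replicate (k : ℕ) :
    increment (List.replicate k true) = List.replicate k false ++ [true] := by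
  induction k with
  | zero => rfl
  | succ k ih => simp [List.replicate_succ, increment, ih]

theorem length_digits (l : ℕ) : (digits l).length = max 1 l.size := by
  unfold digits
  split_ifs with h
  · simp [h]
  · rw [Nat.size_eq_bits_len, max_eq_right]
    exact Nat.size_pos.mpr (Nat.pos_of_ne_zero h)

theorem length_digits_le {l m : ℕ} (hm : 0 < m) : (digits l).length ≤ m ↔ l < 2 ^ m := by
  rw [length_digits, max_le_iff, Nat.size_le]
  exact and_iff_right hm

theorem length_digits_pos (l : ℕ) : 0 < (digits l).length := by
  rw [length_digits]
  exact lt_max_of_lt_left one_pos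

/-! ### Canonical paddings -/

theorem intercalate_append_singleton {α : Type*} (s a : List α) {L : List (List α)}
    (hL : L ≠ []) : s.intercalate (L ++ [a]) = s.intercalate L ++ s ++ a := by
  induction L with
  | nil => exact absurd rfl hL
  | cons b L ih =>
    rcases eq_or_ne L [] with rfl | h
    · simp
    · rw [List.cons_append, List.intercalate_cons_of_ne_nil (by simp), ih h,
        List.intercalate_cons_of_ne_nil h]
      simp

/-- The string `bin(0)$bin(1)$⋯$bin(l)`. -/
def enumeration : ℕ → List (Option Bool)
  | 0 => [some false]
  | l + 1 => enumeration l ++ [none] ++ (digits (l + 1)).reverse.map some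

theorem intercalate_range (l : ℕ) :
    List.intercalate [none] ((List.range (l + 1)).map fun l => (bin l).map some) =
      enumeration l := by
  induction l with
  | zero => simp [enumeration, bin]
  | succ l ih =>
    rw [List.range_succ, List.map_append, List.map_singleton,
      intercalate_append_singleton _ _ (by simp), ih, enumeration, bin_eq]

theorem upperTrack_eq (m : ℕ) : upperTrack m = enumeration (2 ^ m - 1) := by
  rw [← intercalate_range, Nat.sub_add_cancel Nat.one_le_two_pow]
  rfl

/-- The two-track string with upper track `u` and lower track `w`, filled up with `#`. -/
def track (w : List Bool) (u : List (Option Bool)) : List PadSym := u.mapIdx fun i a => (a, w[i]?)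

theorem track_append_singleton (w : List Bool) (u : List (Option Bool)) (a : Option Bool) :
    track w (u ++ [a]) = track w u ++ [(a, w[u.length]?)] := by
  simp [track]

theorem isPadding_track {w : List Bool} {m : ℕ} (hm : 0 < m)
    (hw : w.length ≤ (upperTrack m).length)
    (h : (w.length : ℝ) ≤ (2 : ℝ) ^ ((m : ℝ) / ((bin m).length : ℝ))) :
    IsPadding (track w (upperTrack m)) w := by
  refine ⟨m, hm, ?_, ?_, h⟩
  · refine List.ext_getElem (by simp [track]) fun i _ _ => by simp [track]
  · refine List.ext_getElem (by simp [track]; omega) fun i h1 h2 => ?_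
    rcases Nat.lt_or_ge i w.length with h | h
    · rw [List.getElem_append_left (by simpa using h)]
      simp [track, h]
    · rw [List.getElem_append_right (by simpa using h)]
      simp [track, h]

/-! ### A stack machine that computes paddings -/

/-- States of the padding machine. The stacks are a counter, a buffer for the digits of the
counter, a stack of marks, and the output. -/
inductive PadState where
  | init (i : Fin 32) : PadState
  | count : PadState
  | carry (enumerating : Bool) : PadState
  | shift (enumerating : Bool) : PadState
  | unshift (overflow : Bool) : PadState
  | emit : PadState
  | rewind : PadState
  | clear : PadState
  | check : PadState
  | halt : PadState
  deriving Fintype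

/-- The letter of the output alphabet that represents a binary digit. -/
def digit (b : Bool) : Option PadSym := some (some b, none)

/-- The lower track symbol below which the padding machine writes while scanning `σ`. -/
def TapeSym.lower : TapeSym Bool → Option Bool
  | .letter a => some a
  | _ => none

/-- The transition function of the padding machine. -/
def padδ (s : PadState) (σ : TapeSym Bool) (a : Fin 4 → Option (Option PadSym)) :
    Option (PadState × Dir × (Fin 4 → StackOp (Option PadSym))) :=
  match s with
  | .init i =>
    if i = 0 then some (.count, .right, ![.push (digit false), .nop, .push (digit true), .nop])
    else some (.init (i - 1), .stay, ![.nop, .nop, .push (digit true), .nop])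
  | .count =>
    match σ with
    | .letter _ => some (.carry false, .right, ![.nop, .nop, .nop, .nop])
    | .rightEnd => some (.rewind, .stay, ![.nop, .nop, .nop, .nop])
    | .leftEnd => none
  | .carry e =>
    match a 0 with
    | some (some (some true, _)) =>
      some (.carry e, .stay, ![.pop, .push (digit false), .nop, .nop])
    | some (some (some false, _)) =>
      some (.shift e, .stay, ![.pop, .push (digit true), .nop, .nop])
    | _ =>
      if e then some (.check, .stay, ![.nop, .push (digit true), .pop, .nop])
      else some (.unshift true, .stay, ![.nop, .push (digit true), .nop, .nop])
  | .shift e =>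
    match a 0 with
    | some x => some (.shift e, .stay, ![.pop, .push x, .nop, .nop])
    | none =>
      if e then some (.emit, .right, ![.nop, .nop, .nop, .push (some (none, σ.lower))])
      else some (.unshift false, .stay, ![.nop, .nop, .nop, .nop])
  | .unshift o =>
    match a 1 with
    | some x =>
      some (.unshift o, .stay, ![.push x, .pop, if o then .push (digit true) else .nop, .nop])
    | none => some (.count, .stay, ![.nop, .nop, .nop, .nop])
  | .emit =>
    match a 1 with
    | some (some (b, c)) =>
      some (.emit, .right, ![.push (some (b, c)), .pop, .nop, .push (some (b, σ.lower))])
    | _ => some (.carry true, .stay, ![.nop, .nop, .nop, .nop])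
  | .rewind =>
    match σ with
    | .leftEnd => some (.clear, .right, ![.nop, .nop, .nop, .nop])
    | _ => some (.rewind, .left, ![.nop, .nop, .nop, .nop])
  | .clear =>
    match a 0 with
    | some _ => some (.clear, .stay, ![.pop, .nop, .nop, .nop])
    | none => some (.emit, .stay, ![.nop, .push (digit false), .nop, .nop])
  | .check =>
    match a 2 with
    | some _ => some (.shift true, .stay, ![.nop, .nop, .nop, .nop])
    | none => some (.halt, .stay, ![.nop, .nop, .nop, .push none])
  | .halt => none

/-- The padding machine. -/
abbrev padMachine : StackMachine Bool (Option PadSym) 4 where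
  S := PadState
  finS := inferInstance
  δ := padδ
  s₀ := .init 31

/-! ### Elementary runs of the padding machine -/

namespace padMachine

/-- The configuration with counter `C`, buffer `D`, `M` marks and output `X`. -/
def cfg (s : PadState) (p : ℕ) (C D : List Bool) (M : ℕ) (X : List (Option PadSym)) :
    padMachine.Cfg :=
  ⟨s, p, ![C.map digit, D.map digit, List.replicate M (digit true), X]⟩

variable {w : List Bool} {p M : ℕ} {C D : List Bool} {X : List (Option PadSym)}

theorem step_cfg {s s' : PadState} {p' M' : ℕ} {C' D' : List Bool} {X' : List (Option PadSym)}
    {dir : Dir} {o₀ o₁ o₂ o₃ : StackOp (Option PadSym)}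
    (h : padδ s (tapeOf w p) (fun i => ((cfg s p C D M X).stk i).head?) =
      some (s', dir, ![o₀, o₁, o₂, o₃]))
    (hp : dir.moveOn w.length p = p') (h₀ : o₀.apply (C.map digit) = C'.map digit)
    (h₁ : o₁.apply (D.map digit) = D'.map digit)
    (h₂ : o₂.apply (List.replicate M (digit true)) = List.replicate M' (digit true))
    (h₃ : o₃.apply X = X') :
    padMachine.step w (cfg s p C D M X) = some (cfg s' p' C' D' M' X') := by
  have h' : padMachine.trans w (cfg s p C D M X) = some (s', dir, ![o₀, o₁, o₂, o₃]) := h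
  rw [StackMachine.step, h', Option.map_some, Option.some_inj]
  refine StackMachine.Cfg.ext rfl hp (funext fun i => ?_)
  fin_cases i
  · exact h₀
  · exact h₁
  · exact h₂
  · exact h₃

theorem moveOn_stay (hp : p ≤ w.length + 1) : Dir.stay.moveOn w.length p = p := min_eq_left hp

section

variable (hp : p ≤ w.length + 1)
include hp

theorem run_shift (e : Bool) (l : List Bool) : Steps (padMachine.step w) l.length
    (cfg (.shift e) p l D M X) (cfg (.shift e) p [] (l.reverse ++ D) M X) := by
  induction l generalizing D with
  | nil => rfl
  | cons b l ih =>
    refine Steps.head (step_cfg (C' := l) (D' := b :: D) (X' := X) rfl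
      (moveOn_stay hp) rfl rfl rfl rfl) ?_
    simpa using ih (D := b :: D)

/-- The low-order ones become zeros, the first zero becomes a one, and the remaining digits are only
moved. Every digit is handled once, and the buffer ends with the most significant digit on top. -/
theorem run_carry_of_mem (e : Bool) {l : List Bool} (hl : false ∈ l) :
    Steps (padMachine.step w) l.length (cfg (.carry e) p l D M X)
      (cfg (.shift e) p [] ((increment l).reverse ++ D) M X) := by
  induction l generalizing D with
  | nil => simp at hl
  | cons b l ih =>
    cases b with
    | false =>
      refine Steps.head
        (step_cfg (C' := l) (D' := true :: D) (X' := X) rfl (moveOn_stay hp) rfl rfl rfl rfl) ?_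
      simpa [increment] using run_shift hp e l (D := true :: D)
    | true =>
      refine Steps.head
        (step_cfg (C' := l) (D' := false :: D) (X' := X) rfl (moveOn_stay hp) rfl rfl rfl rfl) ?_
      simpa [increment] using ih (D := false :: D) (by simpa using hl)

theorem run_carry_replicate (e : Bool) (k : ℕ) : Steps (padMachine.step w) k
    (cfg (.carry e) p (List.replicate k true) D M X)
    (cfg (.carry e) p [] (List.replicate k false ++ D) M X) := by
  induction k generalizing D with
  | zero => rfl
  | succ k ih =>
    refine Steps.head (step_cfg (C' := List.replicate k true) (D' := false :: D) (X' := X) rfl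
      (moveOn_stay hp) rfl rfl rfl rfl) ?_
    have := ih (D := false :: D)
    rwa [List.append_cons, ← List.replicate_succ'] at this

/-- If all digits are ones, the carry survives. The new leading one is still missing from the
buffer, hence the `tail`; the overflow step pushes it. -/
theorem run_carry_of_not_mem (e : Bool) {l : List Bool} (hl : false ∉ l) :
    Steps (padMachine.step w) l.length (cfg (.carry e) p l [] M X)
      (cfg (.carry e) p [] (increment l).reverse.tail M X) ∧
      true :: (increment l).reverse.tail = (increment l).reverse := by
  obtain ⟨k, rfl⟩ : ∃ k, l = List.replicate k true := ⟨_, eq_replicate_of_not_mem hl⟩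
  rw [increment_replicate]
  have := run_carry_replicate (w := w) (X := X) (D := []) (M := M) hp e k
  simpa using this

theorem run_unshift (o : Bool) (l : List Bool) : Steps (padMachine.step w) l.length
    (cfg (.unshift o) p C l M X)
    (cfg (.unshift o) p (l.reverse ++ C) [] (M + if o then l.length else 0) X) := by
  induction l generalizing C M with
  | nil => cases o <;> rfl
  | cons b l ih =>
    cases o with
    | false =>
      refine Steps.head
        (step_cfg (C' := b :: C) (D' := l) (M' := M) (X' := X) rfl
        (moveOn_stay hp) rfl rfl rfl rfl) ?_
      simpa using ih (C := b :: C)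
    | true =>
      refine Steps.head
        (step_cfg (C' := b :: C) (D' := l) (M' := M + 1) (X' := X) rfl
        (moveOn_stay hp) rfl rfl rfl rfl) ?_
      have := ih (C := b :: C) (M := M + 1)
      rw [show M + 1 + (if true = true then l.length else 0) =
        M + if true = true then (b :: l).length else 0 by simp; ring] at this
      simpa using this

theorem run_clear (l : List Bool) : Steps (padMachine.step w) l.length
    (cfg .clear p l D M X) (cfg .clear p [] D M X) := by
  induction l with
  | nil => rfl
  | cons b l ih =>
    exact Steps.head (step_cfg (C' := l) rfl (moveOn_stay hp) rfl rfl rfl rfl) ih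

end

/-! ### Counting the input length and collecting marks -/

/-- The number of marks when the counter has `L` digits. -/
def marks (L : ℕ) : ℕ := 31 + ∑ i ∈ Finset.range (L + 1), i

theorem run_init {i : ℕ} (hi : i < 32) :
    Steps (padMachine.step w) (i + 1) (cfg (.init ⟨i, hi⟩) 0 [] [] M [])
      (cfg .count 1 [false] [] (M + i + 1) []) := by
  induction i generalizing M with
  | zero => exact Steps.single (step_cfg rfl (by simp [Dir.moveOn, Dir.move]) rfl rfl rfl rfl)
  | succ i ih =>
    have h : (⟨i + 1, hi⟩ : Fin 32) ≠ 0 := by simp [Fin.ext_iff]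
    have h' : (⟨i + 1, hi⟩ : Fin 32) - 1 = ⟨i, by omega⟩ := by
      rw [Fin.ext_iff, Fin.sub_def]
      simp
      omega
    refine Steps.head (step_cfg (s' := .init ⟨i, by omega⟩) (p' := 0) (C' := []) (D' := []) (M' := M + 1)
      (by rw [padδ, if_neg h, h']) (by simp [Dir.moveOn, Dir.move]) rfl rfl rfl rfl) ?_
    have := ih (M := M + 1) (by omega)
    rwa [show M + 1 + i + 1 = M + (i + 1) + 1 by ring] at this

theorem tapeOf_of_lt {Γ : Type} {w : List Γ} {j : ℕ} (hj : j < w.length) :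
    tapeOf w (j + 1) = .letter w[j] := by
  simp [tapeOf, hj]

/-- Without overflow the number of marks is unchanged. With overflow, moving the digits back from
the buffer adds one mark per digit of the new counter, which is the next summand of `marks`. The
time is the same expression in both cases. -/
theorem run_count_step {j : ℕ} (hj : j < w.length) :
    Steps (padMachine.step w) ((digits j).length + (digits (j + 1)).length + 3)
      (cfg .count (j + 1) (digits j) [] (marks (digits j).length) [])
      (cfg .count (j + 2) (digits (j + 1)) [] (marks (digits (j + 1)).length) []) := by
  have hp : j + 2 ≤ w.length + 1 := by omega
  have h1 : Steps (padMachine.step w) 1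
      (cfg .count (j + 1) (digits j) [] (marks (digits j).length) [])
      (cfg (.carry false) (j + 2) (digits j) [] (marks (digits j).length) []) :=
    Steps.single (step_cfg (by simp only [padδ, tapeOf_of_lt hj]; rfl)
      (by simp only [Dir.moveOn, Dir.move]; omega) rfl rfl rfl rfl)
  have h4 : ∀ M, Steps (padMachine.step w) 1
      (cfg (.unshift true) (j + 2) (digits (j + 1)) [] M [])
      (cfg .count (j + 2) (digits (j + 1)) [] M []) ∧ Steps (padMachine.step w) 1
      (cfg (.unshift false) (j + 2) (digits (j + 1)) [] M [])
      (cfg .count (j + 2) (digits (j + 1)) [] M []) := fun M =>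
    ⟨Steps.single (step_cfg rfl (moveOn_stay hp) rfl rfl rfl rfl),
      Steps.single (step_cfg rfl (moveOn_stay hp) rfl rfl rfl rfl)⟩
  rw [digits_succ] at h4 ⊢
  by_cases hl : false ∈ digits j
  · have h2 := run_carry_of_mem (M := marks (digits j).length) (X := []) (D := []) hp false hl
    have h3 : Steps (padMachine.step w) 1
        (cfg (.shift false) (j + 2) [] ((increment (digits j)).reverse ++ [])
          (marks (digits j).length) [])
        (cfg (.unshift false) (j + 2) [] (increment (digits j)).reverse
          (marks (digits j).length) []) :=
      Steps.single (step_cfg rfl (moveOn_stay hp) rfl (by simp [StackOp.apply]) rfl rfl)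
    have h5 := run_unshift (C := []) (M := marks (digits j).length) (X := []) hp false
      (increment (digits j)).reverse
    simp only [List.reverse_reverse, List.append_nil, List.length_reverse] at h5 h3 h2
    rw [length_increment_of_mem hl] at h5 ⊢
    exact ((((h1.trans h2).trans h3).trans h5).trans (h4 _).2).cast (by ring)
  · obtain ⟨h2, e⟩ := run_carry_of_not_mem (M := marks (digits j).length) (X := []) hp false hl
    have h3 : Steps (padMachine.step w) 1
        (cfg (.carry false) (j + 2) [] (increment (digits j)).reverse.tail
          (marks (digits j).length) [])
        (cfg (.unshift true) (j + 2) [] (increment (digits j)).reverse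
          (marks (digits j).length) []) :=
      Steps.single (step_cfg rfl (moveOn_stay hp) rfl (by rw [← e]; rfl) rfl rfl)
    have h5 := run_unshift (C := []) (M := marks (digits j).length) (X := []) hp true
      (increment (digits j)).reverse
    have hlen : (increment (digits j)).length = (digits j).length + 1 := by
      rw [eq_replicate_of_not_mem hl, increment_replicate]; simp
    have hm : marks (digits j).length + (increment (digits j)).length =
        marks (increment (digits j)).length := by
      rw [marks, marks, Finset.sum_range_succ _ ((increment (digits j)).length), hlen, add_assoc]
    simp only [List.reverse_reverse, List.append_nil, List.length_reverse, if_true] at h5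
    rw [hm] at h5
    exact ((((h1.trans h2).trans h3).trans h5).trans (h4 _).1).cast (by ring)

theorem run_count {j : ℕ} (hj : j ≤ w.length) :
    Steps (padMachine.step w)
      (∑ i ∈ Finset.range j, ((digits i).length + (digits (i + 1)).length + 3))
      (cfg .count 1 [false] [] 32 [])
      (cfg .count (j + 1) (digits j) [] (marks (digits j).length) []) := by
  induction j with
  | zero => exact rfl
  | succ j ih =>
    rw [Finset.sum_range_succ]
    exact (ih (by omega)).trans (run_count_step (by omega))

theorem run_rewind (hp : p ≤ w.length + 1) : Steps (padMachine.step w) (p + 1)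
    (cfg .rewind p C D M X) (cfg .clear 1 C D M X) := by
  induction p with
  | zero =>
    exact Steps.single (step_cfg rfl (by simp [Dir.moveOn, Dir.move]) rfl rfl rfl rfl)
  | succ p ih =>
    have h : ∀ a, padδ .rewind (tapeOf w (p + 1)) a =
        some (.rewind, .left, ![.nop, .nop, .nop, .nop]) := by
      intro a
      rw [tapeOf]
      split <;> rfl
    exact Steps.head (step_cfg (h _) (by simp only [Dir.moveOn, Dir.move]; omega) rfl rfl rfl rfl)
      (ih (by omega))

/-! ### Enumerating the binary numbers and writing the output -/

/-- The configuration with counter `C`, buffer `D` and `M` marks when the symbols `u` of the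
upper track have been written. -/
def enumCfg (w : List Bool) (s : PadState) (C D : List Bool) (M : ℕ) (u : List (Option Bool)) :
    padMachine.Cfg :=
  cfg s (min u.length w.length + 1) C D M ((track w u).map some).reverse

/-- The input head advances with every output symbol and waits at the right endmarker, so it always
supplies the lower track symbol that is due. -/
theorem lower_tapeOf (w : List Bool) (k : ℕ) :
    (tapeOf w (min k w.length + 1)).lower = w[k]? := by
  rcases Nat.lt_or_ge k w.length with h | h
  · rw [min_eq_left h.le, tapeOf_of_lt h, List.getElem?_eq_getElem h]
    rfl
  · simp [tapeOf, TapeSym.lower, h]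

theorem step_write {s s' : PadState} {C' D' : List Bool} {M' : ℕ} {u : List (Option Bool)}
    {a : Option Bool} {o₀ o₁ o₂ : StackOp (Option PadSym)}
    (h : padδ s (tapeOf w (min u.length w.length + 1))
      (fun i => ((enumCfg w s C D M u).stk i).head?) = some (s', .right,
        ![o₀, o₁, o₂, .push (some (a, (tapeOf w (min u.length w.length + 1)).lower))]))
    (h₀ : o₀.apply (C.map digit) = C'.map digit)
    (h₁ : o₁.apply (D.map digit) = D'.map digit)
    (h₂ : o₂.apply (List.replicate M (digit true)) = List.replicate M' (digit true)) :
    padMachine.step w (enumCfg w s C D M u) = some (enumCfg w s' C' D' M' (u ++ [a])) := by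
  refine step_cfg h ?_ h₀ h₁ h₂ ?_
  · simp [Dir.moveOn, Dir.move]
    omega
  · rw [track_append_singleton, lower_tapeOf]
    simp [StackOp.apply]

theorem run_emit {u : List (Option Bool)} (l : List Bool) : Steps (padMachine.step w) l.length
    (enumCfg w .emit C l M u) (enumCfg w .emit (l.reverse ++ C) [] M (u ++ l.map some)) := by
  induction l generalizing C u with
  | nil => simp [Steps]
  | cons b l ih =>
    refine Steps.head
      (step_write (s' := .emit) (C' := b :: C) (D' := l) (M' := M) (a := some b) rfl rfl rfl rfl) ?_
    simpa using ih (C := b :: C) (u := u ++ [some b])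

/-- The number of steps between the enumeration of `l` and that of `l + 1`. -/
def enumTime (l : ℕ) : ℕ :=
  (digits l).length + (digits (l + 1)).length + 2 +
    if false ∈ digits l then 0 else 2

/-- The number of marks plus the number of digits stays `m + 1`, as each overflow consumes one mark.
Since `l + 1 < 2 ^ m`, a mark is left after an overflow and the machine does not halt yet. -/
theorem run_enum_step {m l : ℕ} (hl : l + 1 < 2 ^ m) :
    Steps (padMachine.step w) (enumTime l)
      (enumCfg w (.carry true) (digits l) [] (m + 1 - (digits l).length) (enumeration l))
      (enumCfg w (.carry true) (digits (l + 1)) [] (m + 1 - (digits (l + 1)).length)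
        (enumeration (l + 1))) := by
  have hm : 0 < m := by
    rcases Nat.eq_zero_or_pos m with rfl | h
    · simp at hl
    · exact h
  have hlen := (length_digits_le hm).mpr hl
  have hp : min (enumeration l).length w.length + 1 ≤ w.length + 1 := by omega
  have h3 : ∀ M, Steps (padMachine.step w) 1
      (enumCfg w (.shift true) [] (digits (l + 1)).reverse M (enumeration l))
      (enumCfg w .emit [] (digits (l + 1)).reverse M (enumeration l ++ [none])) := fun M =>
    Steps.single (step_write rfl rfl rfl rfl)
  have h4 : ∀ M, Steps (padMachine.step w) (digits (l + 1)).length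
      (enumCfg w .emit [] (digits (l + 1)).reverse M (enumeration l ++ [none]))
      (enumCfg w .emit (digits (l + 1)) [] M (enumeration (l + 1))) := by
    intro M
    have := run_emit (w := w) (C := []) (M := M) (u := enumeration l ++ [none])
      (digits (l + 1)).reverse
    simpa [enumeration] using this
  have h5 : ∀ M, Steps (padMachine.step w) 1
      (enumCfg w .emit (digits (l + 1)) [] M (enumeration (l + 1)))
      (enumCfg w (.carry true) (digits (l + 1)) [] M (enumeration (l + 1))) := fun M =>
    Steps.single (step_cfg rfl (moveOn_stay (by omega)) rfl rfl rfl rfl)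
  have h345 := fun M => ((h3 M).trans (h4 M)).trans (h5 M)
  unfold enumTime
  by_cases hf : false ∈ digits l
  · have h2 := run_carry_of_mem (D := []) (M := m + 1 - (digits l).length)
      (X := ((track w (enumeration l)).map some).reverse) hp true hf
    rw [List.append_nil, ← digits_succ] at h2
    have e : (digits (l + 1)).length = (digits l).length := by
      rw [digits_succ, length_increment_of_mem hf]
    rw [if_pos hf]
    have := h2.trans (h345 (m + 1 - (digits l).length))
    rw [← e] at this ⊢
    exact this.cast (by ring)
  · obtain ⟨h2, e⟩ := run_carry_of_not_mem (M := m + 1 - (digits l).length)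
      (X := ((track w (enumeration l)).map some).reverse) hp true hf
    rw [← digits_succ] at h2 e
    have e' : (digits (l + 1)).length = (digits l).length + 1 := by
      rw [digits_succ, eq_replicate_of_not_mem hf, increment_replicate]; simp
    have h6 : Steps (padMachine.step w) 1
        (enumCfg w (.carry true) [] (digits (l + 1)).reverse.tail
          (m + 1 - (digits l).length) (enumeration l))
        (enumCfg w .check [] (digits (l + 1)).reverse
          (m + 1 - (digits (l + 1)).length) (enumeration l)) :=
      Steps.single (step_cfg rfl (moveOn_stay hp) rfl (by rw [← e]; rfl)
        (by rw [StackOp.apply, List.tail_replicate, e', Nat.sub_sub]) rfl)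
    obtain ⟨k, hk⟩ : ∃ k, m + 1 - (digits (l + 1)).length = k + 1 :=
      ⟨m - (digits (l + 1)).length, by omega⟩
    have h7 : Steps (padMachine.step w) 1
        (enumCfg w .check [] (digits (l + 1)).reverse (k + 1) (enumeration l))
        (enumCfg w (.shift true) [] (digits (l + 1)).reverse (k + 1) (enumeration l)) :=
      Steps.single (step_cfg rfl (moveOn_stay hp) rfl rfl rfl rfl)
    rw [hk] at h6 ⊢
    rw [if_neg hf]
    exact (((h2.trans h6).trans h7).trans (h345 _)).cast (by ring)

theorem run_enum {m l : ℕ} (hl : l < 2 ^ m) :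
    Steps (padMachine.step w) (∑ i ∈ Finset.range l, enumTime i)
      (enumCfg w (.carry true) [false] [] m [some false])
      (enumCfg w (.carry true) (digits l) [] (m + 1 - (digits l).length) (enumeration l)) := by
  induction l with
  | zero => exact rfl
  | succ l ih =>
    rw [Finset.sum_range_succ]
    exact (ih (by omega)).trans (run_enum_step hl)

/-- The number has at most `m` digits, but its successor has more. Only an increment of a string of
ones lengthens it, and then by exactly one digit. -/
theorem digits_two_pow_sub_one (m : ℕ) (hm : 0 < m) :
    digits (2 ^ m - 1) = List.replicate m true := by
  have h1 : (digits (2 ^ m - 1)).length ≤ m :=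
    (length_digits_le hm).mpr (Nat.sub_lt (by positivity) one_pos)
  have h2 : ¬ (digits (2 ^ m - 1 + 1)).length ≤ m := by
    rw [length_digits_le hm, Nat.sub_add_cancel Nat.one_le_two_pow]
    exact lt_irrefl _
  rw [digits_succ] at h2
  have h3 : false ∉ digits (2 ^ m - 1) := fun h => h2 (length_increment_of_mem h ▸ h1)
  have h4 := eq_replicate_of_not_mem h3
  rw [h4, increment_replicate] at h2
  simp only [List.length_append, List.length_replicate, List.length_singleton] at h2
  rw [h4]
  congr 1
  omega

/-- The size parameter `m` of the padding computed for inputs of length `n`. -/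
def exponent (n : ℕ) : ℕ := marks (digits n).length

/-- The running time of the padding machine on inputs of length `n`. -/
def time (n : ℕ) : ℕ :=
  32 + (∑ i ∈ Finset.range n, ((digits i).length + (digits (i + 1)).length + 3)) +
    (n + (digits n).length + 6) + (∑ i ∈ Finset.range (2 ^ exponent n - 1), enumTime i) +
    (exponent n + 2)

theorem computes : padMachine.Computes 3
    (fun w => track w (upperTrack (exponent w.length))) time := by
  intro w
  set n := w.length with hn
  set m := exponent n with hm
  have hm0 : 0 < m := by rw [hm, exponent, marks]; omega
  have hinit : padMachine.initCfg = cfg (.init 31) 0 [] [] 0 [] := by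
    refine StackMachine.Cfg.ext rfl rfl (funext fun i => ?_)
    fin_cases i <;> rfl
  have h1 : Steps (padMachine.step w) 32 (cfg (.init 31) 0 [] [] 0 [])
      (cfg .count 1 [false] [] 32 []) := run_init (w := w) (M := 0) (i := 31) (by omega)
  have h2 := run_count (w := w) (le_refl n)
  have hend : tapeOf w (n + 1) = .rightEnd := by simp [tapeOf, hn]
  have h3 : Steps (padMachine.step w) 1 (cfg .count (n + 1) (digits n) [] m [])
      (cfg .rewind (n + 1) (digits n) [] m []) :=
    Steps.single (step_cfg (by simp only [padδ, hend]; rfl) (moveOn_stay le_rfl) rfl rfl rfl rfl)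
  have h4 := run_rewind (w := w) (C := digits n) (D := []) (M := m) (X := []) (le_refl (n + 1))
  have h5 := run_clear (w := w) (p := 1) (D := []) (M := m) (X := []) (by omega) (digits n)
  have h6 : Steps (padMachine.step w) 1 (cfg .clear 1 [] [] m [])
      (enumCfg w .emit [] [false] m []) :=
    Steps.single (step_cfg rfl (moveOn_stay (by omega)) rfl rfl rfl rfl)
  have h7 := run_emit (w := w) (C := []) (M := m) (u := []) [false]
  have h8 : Steps (padMachine.step w) 1 (enumCfg w .emit [false] [] m [some false])
      (enumCfg w (.carry true) [false] [] m [some false]) :=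
    Steps.single (step_cfg rfl (moveOn_stay (by omega)) rfl rfl rfl rfl)
  have h9 := run_enum (w := w) (m := m) (l := 2 ^ m - 1) (Nat.sub_lt (by positivity) one_pos)
  rw [digits_two_pow_sub_one m hm0, List.length_replicate, Nat.add_sub_cancel_left,
    ← upperTrack_eq] at h9
  have hp : min (upperTrack m).length w.length + 1 ≤ w.length + 1 := by omega
  -- The counter now consists of `m` ones and a single mark remains. The next overflow consumes it,
  -- so `check` finds no mark, writes the endmarker and halts.
  have h10 := run_carry_replicate (w := w) (D := []) (M := 1)
    (X := ((track w (upperTrack m)).map some).reverse) hp true m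
  have h11 : Steps (padMachine.step w) 1
      (enumCfg w (.carry true) [] (List.replicate m false ++ []) 1 (upperTrack m))
      (enumCfg w .check [] (true :: (List.replicate m false ++ [])) 0 (upperTrack m)) :=
    Steps.single (step_cfg rfl (moveOn_stay hp) rfl rfl rfl rfl)
  have h12 : Steps (padMachine.step w) 1
      (enumCfg w .check [] (true :: (List.replicate m false ++ [])) 0 (upperTrack m))
      (cfg .halt (min (upperTrack m).length w.length + 1) []
        (true :: (List.replicate m false ++ [])) 0
        (none :: ((track w (upperTrack m)).map some).reverse)) :=
    Steps.single (step_cfg rfl (moveOn_stay hp) rfl rfl rfl rfl)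
  refine ⟨_, hinit ▸ (((((((((((h1.trans h2).trans h3).trans h4).trans h5).trans h6).trans
    h7).trans h8).trans h9).trans h10).trans h11).trans h12).cast ?_, rfl, rfl⟩
  -- The `6` in `time` comprises one step into `rewind`, two beyond `n` for rewinding, and three for
  -- starting the enumeration and writing `bin(0)`.
  simp only [time, ← hm, List.length_singleton]
  ring

end padMachine

namespace padMachine

/-! ### The size of the paddings -/

theorem two_mul_marks (L : ℕ) : 2 * marks L = 62 + L * (L + 1) := by
  have := Finset.sum_range_id_mul_two (L + 1)
  rw [Nat.add_sub_cancel] at this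
  rw [marks]
  linarith

/-- It suffices to find `b` with `L * b ≤ marks L < 2 ^ b`. For large `L` the choice `b = L / 2`
works, since `marks L` exceeds `L² / 2` but is only quadratic in `L`; the offset `31` takes care of
small `L`, which are checked one by one. -/
theorem mul_length_digits_marks_le (L : ℕ) : L * (digits (marks L)).length ≤ marks L := by
  obtain ⟨b, hb, h1, h2⟩ : ∃ b, 0 < b ∧ L * b ≤ marks L ∧ marks L < 2 ^ b := by
    rcases Nat.lt_or_ge L 24 with h | h
    · have : ∀ L < 24, ∃ b < 10, 0 < b ∧ L * b ≤ marks L ∧ marks L < 2 ^ b := by decide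
      obtain ⟨b, -, hb⟩ := this L h
      exact ⟨b, hb⟩
    -- With `j = L / 2` one has `L ≤ 2j + 1`, so `marks L` is at most the left-hand side.
    · have key : ∀ j ≥ 12, 31 + (2 * j + 1) * (j + 1) < 2 ^ j := by
        intro j hj
        induction j, hj using Nat.le_induction with
        | base => norm_num
        | succ j hj ih => rw [pow_succ]; nlinarith
      have h2 := two_mul_marks L
      have h3 : 2 * (L / 2) ≤ L := Nat.mul_div_le L 2
      have h4 : L ≤ 2 * (L / 2) + 1 := by omega
      refine ⟨L / 2, by omega, by nlinarith, lt_of_le_of_lt ?_ (key (L / 2) (by omega))⟩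
      nlinarith
  exact (Nat.mul_le_mul_left L ((length_digits_le hb).mpr h2)).trans h1

theorem exponent_pos (n : ℕ) : 0 < exponent n := by
  rw [exponent, marks]
  omega

theorem length_digits_le_exponent (n : ℕ) : (digits n).length ≤ exponent n := by
  rw [exponent, marks, Finset.sum_range_succ]
  omega

theorem lt_two_pow_length_digits (n : ℕ) : n < 2 ^ (digits n).length :=
  (length_digits_le (length_digits_pos n)).mp le_rfl

theorem lt_two_pow_exponent (n : ℕ) : n < 2 ^ exponent n :=
  (length_digits_le (exponent_pos n)).mp (length_digits_le_exponent n)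

theorem le_two_rpow_exponent_div (n : ℕ) :
    (n : ℝ) ≤ (2 : ℝ) ^ ((exponent n : ℝ) / ((bin (exponent n)).length : ℝ)) := by
  have h1 : (n : ℝ) ≤ (2 : ℝ) ^ ((digits n).length : ℝ) := by
    rw [Real.rpow_natCast]
    exact_mod_cast (lt_two_pow_length_digits n).le
  refine h1.trans (Real.rpow_le_rpow_of_exponent_le one_le_two ?_)
  rw [bin_eq, List.length_reverse, le_div_iff₀ (by exact_mod_cast length_digits_pos _)]
  exact_mod_cast mul_length_digits_marks_le _

theorem lt_length_enumeration (l : ℕ) : l < (enumeration l).length := by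
  induction l with
  | zero => simp [enumeration]
  | succ l ih =>
    simp only [enumeration, List.length_append, List.length_singleton]
    omega

theorem length_enumeration_le {m l : ℕ} (hm : 0 < m) (hl : l < 2 ^ m) :
    (enumeration l).length ≤ (l + 1) * (m + 1) := by
  induction l with
  | zero => simp [enumeration]
  | succ l ih =>
    have h := (length_digits_le hm).mpr hl
    simp only [enumeration, List.length_append, List.length_singleton, List.length_map,
      List.length_reverse]
    have := ih (by omega)
    nlinarith

theorem two_pow_le_length_upperTrack (m : ℕ) : 2 ^ m ≤ (upperTrack m).length := by
  rw [upperTrack_eq]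
  have := lt_length_enumeration (2 ^ m - 1)
  omega

theorem length_upperTrack_le {m : ℕ} (hm : 0 < m) : (upperTrack m).length ≤ 2 ^ m * (m + 1) := by
  rw [upperTrack_eq]
  have := length_enumeration_le hm (Nat.sub_lt (Nat.two_pow_pos m) one_pos)
  rwa [Nat.sub_add_cancel Nat.one_le_two_pow] at this

theorem isPadding_track_exponent (w : List Bool) :
    IsPadding (track w (upperTrack (exponent w.length))) w :=
  isPadding_track (exponent_pos _)
    ((lt_two_pow_exponent _).le.trans (two_pow_le_length_upperTrack _))
    (le_two_rpow_exponent_div _)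

/-! ### Running times -/

/-- The enumeration dominates: fewer than `2 ^ m` numbers at a cost linear in `m` each. Factors of
`m` are absorbed by `m + 1 ≤ 2 ^ m`, and the constant is generous. -/
theorem time_le (n : ℕ) : time n ≤ 100 * (2 ^ exponent n) ^ 2 := by
  have hn := lt_two_pow_exponent n
  have hL := length_digits_le_exponent n
  set m := exponent n with hm
  have hm0 : 0 < m := exponent_pos n
  have hmE : m + 1 ≤ 2 ^ m := Nat.lt_two_pow_self
  have h1 : ∑ i ∈ Finset.range n, ((digits i).length + (digits (i + 1)).length + 3) ≤
      n * (2 * m + 3) := by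
    refine (Finset.sum_le_card_nsmul _ _ (2 * m + 3) fun i hi => ?_).trans_eq (by simp)
    have hi := Finset.mem_range.mp hi
    have h := (length_digits_le (l := i) hm0).mpr (by omega)
    have h' := (length_digits_le (l := i + 1) hm0).mpr (by omega)
    omega
  have h2 : ∑ i ∈ Finset.range (2 ^ m - 1), enumTime i ≤ 2 ^ m * (2 * m + 4) := by
    refine (Finset.sum_le_card_nsmul _ _ (2 * m + 4) fun i hi => ?_).trans ?_
    · have hi := Finset.mem_range.mp hi
      have h := (length_digits_le (l := i) hm0).mpr (by omega)
      have h' := (length_digits_le (l := i + 1) hm0).mpr (by omega)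
      unfold enumTime
      split_ifs <;> omega
    · rw [Finset.card_range, smul_eq_mul]
      exact Nat.mul_le_mul_right _ (Nat.sub_le _ _)
  rw [time, ← hm]
  generalize 2 ^ m = E at *
  nlinarith [Nat.mul_le_mul hn.le (show 2 * m + 3 ≤ 2 * E + 3 by omega),
    Nat.mul_le_mul_left E (show 2 * m + 4 ≤ 2 * E + 4 by omega)]

theorem exists_eval_le (p : Polynomial ℕ) :
    ∃ C k, ∀ x, 1 ≤ x → p.eval x ≤ C * x ^ k := by
  refine ⟨∑ i ∈ Finset.range (p.natDegree + 1), p.coeff i, p.natDegree, fun x hx => ?_⟩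
  rw [Polynomial.eval_eq_sum_range, Finset.sum_mul]
  exact Finset.sum_le_sum fun i hi => Nat.mul_le_mul_left _
    (Nat.pow_le_pow_right hx (Nat.lt_succ_iff.mp (Finset.mem_range.mp hi)))

theorem exponent_le (n : ℕ) (hn : 3 ≤ n) : (exponent n : ℝ) ≤ 50 * Real.log n ^ 2 := by
  have hn' : (3 : ℝ) ≤ n := by exact_mod_cast hn
  have hlog : 1 ≤ Real.log n := by
    rw [Real.le_log_iff_exp_le (by linarith)]
    linarith [Real.exp_one_lt_d9]
  -- The number of digits is at most `1 + log n / log 2`, and `1 ≤ log n` because `n ≥ 3 > e`.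
  have hL : ((digits n).length : ℝ) ≤ 3 * Real.log n := by
    obtain ⟨k, hk⟩ : ∃ k, (digits n).length = k + 1 :=
      ⟨_, (Nat.sub_add_cancel (length_digits_pos n)).symm⟩
    rcases Nat.eq_zero_or_pos k with rfl | hk0
    · rw [hk]; push_cast; linarith
    have h1 : 2 ^ k ≤ n := by
      by_contra h
      have := (length_digits_le hk0).mpr (not_le.mp h)
      omega
    have h2 : (k : ℝ) * Real.log 2 ≤ Real.log n := by
      rw [← Real.log_pow]
      exact Real.log_le_log (by positivity) (by exact_mod_cast h1)
    have h3 := Real.log_two_gt_d9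
    rw [hk]
    push_cast
    nlinarith [(Nat.cast_nonneg k : (0 : ℝ) ≤ k)]
  have h := two_mul_marks (digits n).length
  have h' : (2 : ℝ) * (exponent n : ℝ) =
      62 + ((digits n).length : ℝ) * ((digits n).length + 1) := by
    exact_mod_cast h
  have h0 : (0 : ℝ) ≤ (digits n).length := Nat.cast_nonneg _
  nlinarith

end padMachine

/-! ### Quasi-polynomial time bounds are subexponential -/

theorem subexponential_of_le_two_pow {t : ℕ → ℕ} {K : ℝ} {g : ℕ → ℕ} (ht : ∀ n, t n ≤ 2 ^ g n)
    (hK : 0 < K) (hg : ∀ n ≥ 3, (g n : ℝ) ≤ K * Real.log n ^ 2) : Subexponential t := by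
  -- This exponent solves `n ^ e n = K * (log n)²`; it tends to zero because `log log n` is
  -- negligible against `log n`.
  refine ⟨fun n => (Real.log K + 2 * Real.log (Real.log n)) / Real.log n, ?_, ?_⟩
  · have h1 : Tendsto (fun x : ℝ => (Real.log K + 2 * Real.log x) / x) atTop (𝓝 0) := by
      have h2 : Tendsto (fun x : ℝ => Real.log K / x) atTop (𝓝 0) :=
        tendsto_const_nhds.div_atTop tendsto_id
      have h3 : Tendsto (fun x : ℝ => Real.log x / x) atTop (𝓝 0) :=
        Real.isLittleO_log_id_atTop.tendsto_div_nhds_zero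
      have h4 := h2.add (h3.const_mul 2)
      simp only [mul_zero, add_zero] at h4
      refine h4.congr fun x => ?_
      ring
    exact h1.comp (Real.tendsto_log_atTop.comp tendsto_natCast_atTop_atTop)
  · filter_upwards [eventually_ge_atTop 3] with n hn
    have hn' : (3 : ℝ) ≤ n := by exact_mod_cast hn
    have hlog : 0 < Real.log n := Real.log_pos (by linarith)
    have h1 : (n : ℝ) ^ ((Real.log K + 2 * Real.log (Real.log n)) / Real.log n) =
        K * Real.log n ^ 2 := by
      rw [Real.rpow_def_of_pos (by linarith), mul_div_cancel₀ _ hlog.ne', Real.exp_add,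
        Real.exp_log hK, mul_comm (2 : ℝ), Real.exp_mul, Real.exp_log hlog]
      norm_num
    rw [h1]
    calc (t n : ℝ) ≤ (2 : ℝ) ^ (g n : ℝ) := by
          rw [Real.rpow_natCast]
          exact_mod_cast ht n
      _ ≤ _ := Real.rpow_le_rpow_of_exponent_le one_le_two (hg n hn)

namespace padMachine

theorem subexponential (p : Polynomial ℕ) :
    Subexponential fun n => 2 * time n + (upperTrack (exponent n)).length + 3 +
      p.eval (upperTrack (exponent n)).length := by
  obtain ⟨C, k, hp⟩ := exists_eval_le p
  -- With `E = 2 ^ exponent n`, the four summands are at most `200 E²`, `E²`, `3` and `C * E ^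
  -- (2k)`, together at most `(204 + C) * E ^ (2k + 2)`. The factor `204 + C` is absorbed into the
  -- power of two, and `50` comes from `exponent_le`.
  refine subexponential_of_le_two_pow (K := 204 + C + (2 * k + 2) * 50)
    (g := fun n => (204 + C) + exponent n * (2 * k + 2)) (fun n => ?_) (by positivity)
    fun n hn => ?_
  · have h1 := time_le n
    have h2 := length_upperTrack_le (exponent_pos n)
    have h3 := two_pow_le_length_upperTrack (exponent n)
    have h4 : exponent n + 1 ≤ 2 ^ exponent n := Nat.lt_two_pow_self
    have h5 := hp _ (Nat.one_le_two_pow.trans h3)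
    have hE : 1 ≤ 2 ^ exponent n := Nat.one_le_two_pow
    have h6 : (upperTrack (exponent n)).length ≤ (2 ^ exponent n) ^ 2 := by
      rw [sq]
      exact h2.trans (Nat.mul_le_mul_left _ h4)
    rw [pow_add, pow_mul]
    generalize 2 ^ exponent n = E at *
    have h7 : p.eval (upperTrack (exponent n)).length ≤ C * E ^ (2 * k + 2) := by
      refine h5.trans (Nat.mul_le_mul_left _ ((Nat.pow_le_pow_left h6 k).trans ?_))
      rw [← pow_mul]
      exact Nat.pow_le_pow_right hE (by omega)
    have h8 : E ^ 2 ≤ E ^ (2 * k + 2) := Nat.pow_le_pow_right hE (by omega)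
    have h9 : 1 ≤ E ^ 2 := Nat.one_le_pow _ _ hE
    calc _ ≤ (204 + C) * E ^ (2 * k + 2) := by linarith
      _ ≤ _ := Nat.mul_le_mul_right _ Nat.lt_two_pow_self.le
  · have h1 := exponent_le n hn
    have hn' : (3 : ℝ) ≤ n := by exact_mod_cast hn
    have hlog : 1 ≤ Real.log n := by
      rw [Real.le_log_iff_exp_le (by linarith)]
      linarith [Real.exp_one_lt_d9]
    push_cast
    have h2 : (204 + C : ℝ) ≤ (204 + C) * Real.log n ^ 2 :=
      le_mul_of_one_le_right (by positivity) (one_le_pow₀ hlog)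
    have h3 : (exponent n : ℝ) * (2 * k + 2) ≤ 50 * Real.log n ^ 2 * (2 * k + 2) :=
      mul_le_mul_of_nonneg_right h1 (by positivity)
    linarith

end padMachine

-- The canonical padding maps yes-instances to yes-instances and no-instances to no-instances, so a
-- polynomial-time machine for the padded problem yields a subexponential one for `A` of the same
-- kind, quantum or Merlin–Arthur.
open padMachine in
theorem padProblem_not_mem (hETH : ETHQMA) {A : PromiseProblem Bool} (hA : QMAComplete A) :
    padProblem A ∉ BQP PadSym ∧ padProblem A ∉ MA PadSym := by
  have hℓ : ∀ w : List Bool, (track w (upperTrack (exponent w.length))).length =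
      (upperTrack (exponent w.length)).length := fun w => List.length_mapIdx
  have hyes : ∀ w ∈ A.yes, track w (upperTrack (exponent w.length)) ∈ (padProblem A).yes :=
    fun w hw => ⟨w, hw, isPadding_track_exponent w⟩
  have hno : ∀ w ∈ A.no, track w (upperTrack (exponent w.length)) ∈ (padProblem A).no :=
    fun w hw => Or.inl ⟨w, hw, isPadding_track_exponent w⟩
  refine ⟨fun ⟨p, hp⟩ => ?_, fun ⟨p, hp⟩ => ?_⟩
  · have h := BQTIME_of_computes (t := fun n => p.eval n)
      (ℓ := fun n => (upperTrack (exponent n)).length) computes hℓ hyes hno hp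
    exact hETH _ (subexponential p) Bool A hA (Or.inr h)
  · have h := MATIME_of_computes (t := fun n => p.eval n)
      (ℓ := fun n => (upperTrack (exponent n)).length) computes hℓ hyes hno hp
    exact hETH _ (subexponential p) Bool A hA (Or.inl h)

end PaddedQMA

theorem theorem2 (hETH : PaddedQMA.ETHQMA) :
    ∀ A' ∈ PaddedQMA.familyF,
      A' ∉ PaddedQMA.BQP PaddedQMA.PadSym ∧ A' ∉ PaddedQMA.MA PaddedQMA.PadSym := by
  rintro _ ⟨A, hA, rfl⟩
  exact PaddedQMA.padProblem_not_mem hETH hA
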